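/- Let $\delta\in(0,1)$ be a discount factor, $\kappa\ge 0$ a per-round search cost, $X\subset\mathbb R_+$ a Borel set with $0\in X$, and $x_0>0$ an outside option. Let $\mathcal F_X$ be the set of all probability distributions over $X$ (environments) with a finite mean. Alternatives $x_1,x_2,\dots$ are drawn i.i.d. from an environment $F\in\mathcal F_X$. A decision rule $p$ prescribes, after each history $h=(x_0,x_1,\dots,x_n)$, a probability $p(h)\in[0,1]$ of stopping (measurably in $h$). From the perspective of round $n$, stopping $t$ rounds later yields $-(\delta+\dots+\delta^t)\kappa+\delta^t\max\{x_0,x_1,\dots,x_{n+t}\}$; never stopping yields $-\delta\kappa/(1-\delta)$. A prior $\mu$ is a finitely supported probability distribution over $\mathcal F_X$; it is consistent with $h$ if $x_1,\dots,x_n$ occurs with positive probability under $\mu$. Let $U_p(\mu,h)$ be the expected payoff of $p$ under $\mu$ conditional on $h$ (with $\mu$ updated by Bayes' rule), and $V(\mu,h)=\sup_p U_p(\mu,h)$. The performance ratio of $p$ is \[ R_p(x_0,\mathcal F_X)=\inf\left\{\frac{U_p(\mu,h)}{V(\mu,h)} : h \text{ a history with outside option } x_0,\ \mu \text{ a prior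 consistent with } h\right\}, \] and $p$ is called dynamically robust if $R_p(x_0,\mathcal F_X)=\sup_{q}R_q(x_0,\mathcal F_X)$, the supremum being over all decision rules $q$. Suppose that $x_0\ge \frac{2\delta\kappa}{1-\delta}$. Then the stationary decision rule $\bar p$ that stops with probability $\frac{1-\delta}{2-\delta}$ after every history (a) attains a performance ratio $R_{\bar p}(x_0,\mathcal F_X)\ge \frac14$; (b) is dynamically robust if $\sup X=\infty$. -/

import Mathlib

open MeasureTheory

noncomputable section

namespace RobustSearch

/-- A decision rule. A history `(x₀, x₁, …, xₙ)` with the (fixed) outside option `x₀` is represented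
by the alternatives `(x₁, …, xₙ)` found so far, and `stopProb n h` is the probability of stopping
after that history. -/
structure Rule where
  stopProb : (n : ℕ) → (Fin n → ℝ) → ℝ
  measurable_stopProb : ∀ n, Measurable (stopProb n)
  stopProb_mem : ∀ n h, stopProb n h ∈ Set.Icc (0 : ℝ) 1

/-- The rule that stops with the same probability `q` after every history. -/
def Rule.const (q : ℝ) (hq : q ∈ Set.Icc (0 : ℝ) 1) : Rule where
  stopProb _ _ := q
  measurable_stopProb _ := measurable_const
  stopProb_mem _ _ := hq

/-- The number `(1 - δ) / (2 - δ)` is a probability. -/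
theorem one_sub_div_mem {δ : ℝ} (h0 : 0 < δ) (h1 : δ < 1) :
    (1 - δ) / (2 - δ) ∈ Set.Icc (0 : ℝ) 1 :=
  ⟨div_nonneg (by linarith) (by linarith), (div_le_one (by linarith)).2 (by linarith)⟩

/-- The best-so-far alternative `max {x₀, x₁, …, xₙ}`. -/
def best (x₀ : ℝ) {n : ℕ} (h : Fin n → ℝ) : ℝ :=
  Finset.univ.fold max x₀ h

/-- The history `h` followed by the first `t` terms of the sequence `ω` of future alternatives. -/
def extendHist {n : ℕ} (h : Fin n → ℝ) (ω : ℕ → ℝ) (t : ℕ) : Fin (n + t) → ℝ :=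
  Fin.append h (fun i : Fin t => ω i)

/-- The conditional probability, given the history `h` and the future alternatives `ω`, that the
rule `p` stops exactly `t` rounds after `h`. -/
def stopWeight (p : Rule) {n : ℕ} (h : Fin n → ℝ) (ω : ℕ → ℝ) (t : ℕ) : ℝ :=
  (∏ s ∈ Finset.range t, (1 - p.stopProb (n + s) (extendHist h ω s))) *
    p.stopProb (n + t) (extendHist h ω t)

/-- The payoff, seen from the round of the history `h`, of stopping `t` rounds after `h`:
`-(δ + ⋯ + δ ^ t) κ + δ ^ t y`, where `y` is the best alternative available then. -/
def stopPayoff (δ κ x₀ : ℝ) {n : ℕ} (h : Fin n → ℝ) (ω : ℕ → ℝ) (t : ℕ) : ℝ :=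
  -(∑ k ∈ Finset.Icc 1 t, δ ^ k) * κ + δ ^ t * best x₀ (extendHist h ω t)

/-- The law of an infinite i.i.d. sequence of alternatives drawn from the environment `F`. -/
def iidLaw (F : ProbabilityMeasure ℝ) : Measure (ℕ → ℝ) :=
  Measure.infinitePi (fun _ : ℕ => (F : Measure ℝ))

/-- The expected payoff `U_p(F, h)` of the rule `p` in the environment `F`, from the history `h` on.
The last term accounts for the event that the rule never stops, in which case only the
search costs `κ (δ + δ ^ 2 + ⋯) = δ κ / (1 - δ)` accrue. -/
def envPayoff (δ κ x₀ : ℝ) (p : Rule) (F : ProbabilityMeasure ℝ) {n : ℕ} (h : Fin n → ℝ) : ℝ :=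
  (∑' t : ℕ, ∫ ω, stopWeight p h ω t * stopPayoff δ κ x₀ h ω t ∂(iidLaw F))
    - (1 - ∑' t : ℕ, ∫ ω, stopWeight p h ω t ∂(iidLaw F)) * (δ * κ / (1 - δ))

/-- The set `𝓕_X` of all probability distributions over `X` that have a finite mean. -/
def environments (X : Set ℝ) : Set (ProbabilityMeasure ℝ) :=
  {F | (F : Measure ℝ) Xᶜ = 0 ∧ Integrable (fun x : ℝ => x) (F : Measure ℝ)}

/-- A prior (equivalently, a mixed environment): a probability distribution with finite support over
the set `𝓕` of feasible environments. -/
structure Prior (𝓕 : Set (ProbabilityMeasure ℝ)) where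
  weight : ProbabilityMeasure ℝ →₀ ℝ
  nonneg : ∀ F, 0 ≤ weight F
  sum_eq_one : ∑ F ∈ weight.support, weight F = 1
  support_subset : ∀ F ∈ weight.support, F ∈ 𝓕

/-- The probability that `n` independent draws from `F` give exactly the alternatives `h`. -/
def likelihood (F : ProbabilityMeasure ℝ) {n : ℕ} (h : Fin n → ℝ) : ℝ :=
  ∏ i, (F : Measure ℝ).real {h i}

namespace Prior

variable {𝓕 : Set (ProbabilityMeasure ℝ)}

/-- The probability of the alternatives `h` under the prior `μ`. -/
def histProb (μ : Prior 𝓕) {n : ℕ} (h : Fin n → ℝ) : ℝ :=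
  ∑ F ∈ μ.weight.support, μ.weight F * likelihood F h

/-- The prior is consistent with a history if that history has positive probability under it. -/
def Consistent (μ : Prior 𝓕) {n : ℕ} (h : Fin n → ℝ) : Prop :=
  0 < μ.histProb h

/-- The posterior probability `μ(F | h)` of the environment `F`, by Bayes' rule. -/
def posterior (μ : Prior 𝓕) {n : ℕ} (h : Fin n → ℝ) (F : ProbabilityMeasure ℝ) : ℝ :=
  μ.weight F * likelihood F h / μ.histProb h

/-- The expected payoff `U_p(μ, h)` of the rule `p` under the prior `μ`, conditional on `h`. -/
def payoff (δ κ x₀ : ℝ) (p : Rule) (μ : Prior 𝓕) {n : ℕ} (h : Fin n → ℝ) : ℝ :=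
  ∑ F ∈ μ.weight.support, μ.posterior h F * envPayoff δ κ x₀ p F h

/-- The optimal payoff `V(μ, h) = sup_p U_p(μ, h)`. -/
def optPayoff (δ κ x₀ : ℝ) (μ : Prior 𝓕) {n : ℕ} (h : Fin n → ℝ) : ℝ :=
  ⨆ p : Rule, μ.payoff δ κ x₀ p h

end Prior

/-- The performance ratio `R_p(x₀, 𝓕)`: the infimum of the payoff ratio `U_p(μ, h) / V(μ, h)` over
all histories and all priors consistent with them. -/
def performanceRatio (δ κ x₀ : ℝ) (𝓕 : Set (ProbabilityMeasure ℝ)) (p : Rule) : EReal :=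
  ⨅ (n : ℕ) (h : Fin n → ℝ) (μ : Prior 𝓕) (_ : μ.Consistent h),
    ((μ.payoff δ κ x₀ p h / μ.optPayoff δ κ x₀ h : ℝ) : EReal)

/-- The dynamically robust performance ratio `R^*(x₀, 𝓕) = sup_p R_p(x₀, 𝓕)`. -/
def robustRatio (δ κ x₀ : ℝ) (𝓕 : Set (ProbabilityMeasure ℝ)) : EReal :=
  ⨆ p : Rule, performanceRatio δ κ x₀ 𝓕 p

/-- A rule is dynamically robust if it attains the dynamically robust performance ratio. -/
def DynamicallyRobust (δ κ x₀ : ℝ) (𝓕 : Set (ProbabilityMeasure ℝ)) (p : Rule) : Prop :=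
  performanceRatio δ κ x₀ 𝓕 p = robustRatio δ κ x₀ 𝓕

end RobustSearch

end

noncomputable section

namespace RobustSearch

open Filter Topology

/-! Put `K = δκ/(1-δ)`. Stopping after `t` more rounds with best alternative `y` pays `δ^t (y + K) -
K`, and never stopping pays `-K`. So, up to the constant `K`, search is free and every alternative
is worth `K` more; the cost assumption says `x₀ ≥ 2K`, hence `y + K ≥ 3K` always. Finite-horizon
values satisfy a Bellman recursion (`truncValue_succ`) and converge to the payoff
(`tendsto_truncValue`), so all bounds are inductions on the horizon.

Lower bound. In an environment `F`, let `R` be the reservation level, raised to the current value `y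
+ K` if that is larger. No rule gets more than `R` (`truncValue_le`), so no payoff exceeds `R - K`.
The stationary rule gets at least `R/4 + 3K/4` in shifted units (`le_truncValue_const`), that is, a
payoff of at least `(R - K)/4`. Both bounds survive averaging over the posterior, so the ratio is at
least `1/4` even against a benchmark that knows `F`.

Upper bound. For a rule `p`, let `d` be the expected discount factor at stopping when only zeros
follow a history, and `D` the supremum of `d` over histories in `X`. Take a history with `d > D - ε`
and an environment that yields a huge `z` with tiny probability `σ`. The rule collects `z` only if
it is still searching when `z` appears, a discounted chance of about `σ(1-d)δ/(1-δ)`, and then gets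
at most about `Dz` (`truncValue_le_of_not_found`). Waiting for `z` earns about `σzδ/(1-δ)`
(`le_truncValue_threshold`). The ratio is about `D(1-d) ≤ D(1-D) + ε ≤ 1/4 + ε`: stopping must be
likely after `z` and unlikely before it, but both histories obey the same bound `D`. -/

/-! ### Prepending a term to an i.i.d. sequence -/

/-- The sequence `x, ω 0, ω 1, …`. -/
def consSeq (x : ℝ) (ω : ℕ → ℝ) : ℕ → ℝ
  | 0 => x
  | i + 1 => ω i

theorem measurable_consSeq : Measurable fun q : ℝ × (ℕ → ℝ) => consSeq q.1 q.2 := by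
  refine measurable_pi_lambda _ fun i => ?_
  cases i with
  | zero => exact measurable_fst
  | succ i => exact (measurable_pi_apply i).comp measurable_snd

instance (F : ProbabilityMeasure ℝ) : IsProbabilityMeasure (iidLaw F) := by
  unfold iidLaw; infer_instance

theorem map_consSeq (F : ProbabilityMeasure ℝ) :
    ((F : Measure ℝ).prod (iidLaw F)).map (fun q => consSeq q.1 q.2) = iidLaw F := by
  refine Measure.eq_infinitePi _ fun s t ht => ?_
  classical
  obtain ⟨N, hN⟩ : ∃ N, s ⊆ Finset.range (N + 1) := by
    obtain ⟨N, hN⟩ := s.exists_nat_subset_range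
    exact ⟨N, hN.trans (Finset.range_mono (Nat.le_succ N))⟩
  -- Trivial constraints fill the cylinder up to an initial segment, so that coordinate `0` can be
  -- split off.
  let t' : ℕ → Set ℝ := fun i => if i ∈ s then t i else Set.univ
  have ht' : ∀ i, MeasurableSet (t' i) := fun i => by
    by_cases h : i ∈ s
    · simpa [t', h] using ht i
    · simp [t', h]
  have hpre : (fun q : ℝ × (ℕ → ℝ) => consSeq q.1 q.2) ⁻¹' (Set.pi s t) =
      t' 0 ×ˢ Set.pi (Finset.range N : Finset ℕ) (fun i => t' (i + 1)) := by
    ext ⟨x, ω⟩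
    simp only [Set.mem_preimage, Set.mem_pi, Set.mem_prod, Finset.mem_coe, t']
    constructor
    · intro h
      refine ⟨?_, fun i _ => ?_⟩
      · split_ifs with h0
        · exact h 0 h0
        · trivial
      · split_ifs with h0
        · exact h (i + 1) h0
        · trivial
    · rintro ⟨h0, h1⟩ i hi
      cases i with
      | zero => simpa [hi, consSeq] using h0
      | succ i =>
        have := h1 i (by have := Finset.mem_range.1 (hN hi); exact Finset.mem_range.2 (by omega))
        simpa [hi, consSeq] using this
  have hprod : ∏ i ∈ s, (F : Measure ℝ) (t i) =
      ∏ i ∈ Finset.range (N + 1), (F : Measure ℝ) (t' i) := by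
    rw [← Finset.prod_subset hN]
    · exact Finset.prod_congr rfl fun i hi => by simp [t', hi]
    · intro i _ hi
      simp [t', hi]
  rw [Measure.map_apply measurable_consSeq
    (MeasurableSet.pi s.countable_toSet fun i hi => ht i), hpre, Measure.prod_prod, iidLaw,
    Measure.infinitePi_pi _ fun i _ => ht' (i + 1), hprod, Finset.prod_range_succ', mul_comm]

theorem integrable_coord {F : ProbabilityMeasure ℝ}
    (hF : Integrable (fun x : ℝ => x) (F : Measure ℝ)) (i : ℕ) :
    Integrable (fun ω : ℕ → ℝ => ω i) (iidLaw F) :=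
  (measurePreserving_eval_infinitePi (fun _ : ℕ => (F : Measure ℝ)) i).integrable_comp_of_integrable
    hF

/-! ### Histories as prefixes of infinite paths -/

/-- The path that follows `v` before time `m` and then runs through `ω`. -/
def splice (m : ℕ) (v ω : ℕ → ℝ) : ℕ → ℝ := fun i => if i < m then v i else ω (i - m)

/-- The history `h`, continued by zeros. -/
def pad {n : ℕ} (h : Fin n → ℝ) : ℕ → ℝ := fun i => if hi : i < n then h ⟨i, hi⟩ else 0

theorem measurable_splice (m : ℕ) (v : ℕ → ℝ) : Measurable (splice m v) := by
  refine measurable_pi_lambda _ fun i => ?_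
  unfold splice
  split_ifs
  · exact measurable_const
  · exact measurable_pi_apply _

/-- Moves the first future draw into the past; with `map_consSeq` this is conditioning on the next
alternative. -/
theorem splice_consSeq (m : ℕ) (v ω : ℕ → ℝ) (x : ℝ) :
    splice m v (consSeq x ω) = splice (m + 1) (Function.update v m x) ω := by
  funext i
  unfold splice
  rcases lt_trichotomy i m with h | h | h
  · simp [h, h.ne, Nat.lt_succ_of_lt h]
  · subst h; simp [consSeq]
  · obtain ⟨k, rfl⟩ := Nat.exists_eq_add_of_lt h
    have h1 : m + k + 1 - m = k + 1 := by omega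
    have h2 : m + k + 1 - (m + 1) = k := by omega
    simp [h1, h2, consSeq]
    omega

/-- The stopping probability of `p` after the first `m` terms of the path `v`. -/
def pathStop (p : Rule) (m : ℕ) (v : ℕ → ℝ) : ℝ := p.stopProb m fun i => v i

/-- The best-so-far alternative after the first `m` terms of the path `v`. -/
def pathBest (x₀ : ℝ) (m : ℕ) (v : ℕ → ℝ) : ℝ := best x₀ fun i : Fin m => v i

theorem extendHist_eq_splice {n : ℕ} (h : Fin n → ℝ) (ω : ℕ → ℝ) (t : ℕ) :
    extendHist h ω t = fun i : Fin (n + t) => splice n (pad h) ω i := by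
  funext i
  refine Fin.addCases (fun j => ?_) (fun j => ?_) i
  · simp [extendHist, splice, pad]
  · simp [extendHist, splice]

theorem best_le_iff {x₀ c : ℝ} {n : ℕ} {h : Fin n → ℝ} :
    best x₀ h ≤ c ↔ x₀ ≤ c ∧ ∀ i, h i ≤ c := by
  simp [best, Finset.fold_max_le]

@[simp] theorem pathBest_zero (x₀ : ℝ) (v : ℕ → ℝ) : pathBest x₀ 0 v = x₀ := by
  simp [pathBest, best]

theorem pathBest_succ (x₀ : ℝ) (m : ℕ) (v : ℕ → ℝ) :
    pathBest x₀ (m + 1) v = max (pathBest x₀ m v) (v m) := by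
  refine eq_of_forall_ge_iff fun c => ?_
  simp only [pathBest, max_le_iff, best_le_iff, Fin.forall_fin_succ', Fin.val_castSucc,
    Fin.val_last]
  tauto

theorem le_pathBest (x₀ : ℝ) (m : ℕ) (v : ℕ → ℝ) : x₀ ≤ pathBest x₀ m v :=
  (best_le_iff.1 le_rfl).1

theorem pathBest_congr (x₀ : ℝ) {m : ℕ} {v w : ℕ → ℝ} (h : ∀ i < m, v i = w i) :
    pathBest x₀ m v = pathBest x₀ m w := by
  unfold pathBest
  congr 1
  funext i
  exact h i i.2

theorem pathStop_congr (p : Rule) {m : ℕ} {v w : ℕ → ℝ} (h : ∀ i < m, v i = w i) :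
    pathStop p m v = pathStop p m w := by
  unfold pathStop
  congr 1
  funext i
  exact h i i.2

theorem pathBest_update (x₀ : ℝ) (m : ℕ) (v : ℕ → ℝ) (x : ℝ) :
    pathBest x₀ (m + 1) (Function.update v m x) = max (pathBest x₀ m v) x := by
  rw [pathBest_succ, Function.update_self,
    pathBest_congr x₀ (fun i hi => Function.update_of_ne hi.ne _ _)]

theorem pathStop_nonneg (p : Rule) (m : ℕ) (v : ℕ → ℝ) : 0 ≤ pathStop p m v :=
  (p.stopProb_mem m _).1

theorem pathStop_le_one (p : Rule) (m : ℕ) (v : ℕ → ℝ) : pathStop p m v ≤ 1 :=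
  (p.stopProb_mem m _).2

theorem measurable_pathStop (p : Rule) (m : ℕ) : Measurable (pathStop p m) :=
  (p.measurable_stopProb m).comp (measurable_pi_lambda _ fun _ => measurable_pi_apply _)

theorem measurable_pathBest (x₀ : ℝ) (m : ℕ) : Measurable (pathBest x₀ m) := by
  induction m with
  | zero => simp [funext (pathBest_zero x₀)]
  | succ m ih =>
    simp only [funext (pathBest_succ x₀ m)]
    exact ih.max (measurable_pi_apply m)

/-- The probability of stopping exactly `t` rounds after time `m` along the path `v`. -/
def pathWeight (p : Rule) (m t : ℕ) (v : ℕ → ℝ) : ℝ :=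
  (∏ s ∈ Finset.range t, (1 - pathStop p (m + s) v)) * pathStop p (m + t) v

theorem pathWeight_zero (p : Rule) (m : ℕ) (v : ℕ → ℝ) :
    pathWeight p m 0 v = pathStop p m v := by
  simp [pathWeight]

theorem pathWeight_succ (p : Rule) (m t : ℕ) (v : ℕ → ℝ) :
    pathWeight p m (t + 1) v = (1 - pathStop p m v) * pathWeight p (m + 1) t v := by
  have h : ∀ s, m + 1 + s = m + (s + 1) := fun s => by omega
  simp only [pathWeight, Finset.prod_range_succ', h, add_zero]
  ring

theorem pathWeight_nonneg (p : Rule) (m t : ℕ) (v : ℕ → ℝ) : 0 ≤ pathWeight p m t v :=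
  mul_nonneg (Finset.prod_nonneg fun _ _ => sub_nonneg.2 (pathStop_le_one p _ _))
    (pathStop_nonneg p _ _)

theorem sum_pathWeight_le_one (p : Rule) (T m : ℕ) (v : ℕ → ℝ) :
    ∑ t ∈ Finset.range T, pathWeight p m t v ≤ 1 := by
  induction T generalizing m with
  | zero => simp
  | succ T ih =>
    simp only [Finset.sum_range_succ', pathWeight_succ, pathWeight_zero, ← Finset.mul_sum]
    nlinarith [ih (m + 1), pathStop_le_one p m v, pathStop_nonneg p m v]

theorem pathWeight_le_one (p : Rule) (m t : ℕ) (v : ℕ → ℝ) : pathWeight p m t v ≤ 1 :=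
  (Finset.single_le_sum (fun s _ => pathWeight_nonneg p m s v)
    (Finset.self_mem_range_succ t)).trans (sum_pathWeight_le_one p (t + 1) m v)

theorem measurable_pathWeight (p : Rule) (m t : ℕ) : Measurable (pathWeight p m t) :=
  (Finset.measurable_fun_prod _ fun _ _ => measurable_const.sub (measurable_pathStop p _)).mul
    (measurable_pathStop p _)

theorem stopWeight_eq (p : Rule) {n : ℕ} (h : Fin n → ℝ) (ω : ℕ → ℝ) (t : ℕ) :
    stopWeight p h ω t = pathWeight p n t (splice n (pad h) ω) := by
  simp only [stopWeight, pathWeight, pathStop, extendHist_eq_splice]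

/-! ### Payoffs truncated at a finite horizon -/

/-- The discounted payoff along the path `v`, from time `m` on, of the rounds before `m + T`, where
every alternative is worth `K` more and search is free. -/
def truncPayoff (δ K x₀ : ℝ) (p : Rule) : ℕ → ℕ → (ℕ → ℝ) → ℝ
  | 0, _, _ => 0
  | T + 1, m, v => pathStop p m v * (pathBest x₀ m v + K) +
      (1 - pathStop p m v) * (δ * truncPayoff δ K x₀ p T (m + 1) v)

theorem truncPayoff_eq_sum (δ K x₀ : ℝ) (p : Rule) (T m : ℕ) (v : ℕ → ℝ) :
    truncPayoff δ K x₀ p T m v =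
      ∑ t ∈ Finset.range T, δ ^ t * (pathWeight p m t v * (pathBest x₀ (m + t) v + K)) := by
  induction T generalizing m with
  | zero => simp [truncPayoff]
  | succ T ih =>
    have h : ∀ s, m + 1 + s = m + (s + 1) := fun s => by omega
    rw [Finset.sum_range_succ', truncPayoff, ih, Finset.mul_sum, Finset.mul_sum, add_comm]
    simp only [pathWeight_succ, pathWeight_zero, h]
    congr 1
    · exact Finset.sum_congr rfl fun t _ => by ring
    · simp

theorem integrable_pathBest_splice (x₀ : ℝ) {F : ProbabilityMeasure ℝ}
    (hF : Integrable (fun x : ℝ => x) (F : Measure ℝ)) (k m : ℕ) (v : ℕ → ℝ) :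
    Integrable (fun ω => pathBest x₀ k (splice m v ω)) (iidLaw F) := by
  induction k with
  | zero => simp
  | succ k ih =>
    simp only [pathBest_succ]
    refine ih.sup ?_
    unfold splice
    split_ifs
    · exact integrable_const _
    · exact integrable_coord hF _

theorem integrable_truncPayoff_splice (δ K x₀ : ℝ) (p : Rule) {F : ProbabilityMeasure ℝ}
    (hF : Integrable (fun x : ℝ => x) (F : Measure ℝ)) (T k m : ℕ) (v : ℕ → ℝ) :
    Integrable (fun ω => truncPayoff δ K x₀ p T k (splice m v ω)) (iidLaw F) := by
  induction T generalizing k with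
  | zero => simp [truncPayoff]
  | succ T ih =>
    simp only [truncPayoff]
    have hm : Measurable fun ω => pathStop p k (splice m v ω) :=
      (measurable_pathStop p k).comp (measurable_splice m v)
    refine Integrable.add ?_ ?_
    · refine ((integrable_pathBest_splice x₀ hF k m v).add (integrable_const K)).bdd_mul (c := 1)
        hm.aestronglyMeasurable (ae_of_all _ fun ω => ?_)
      rw [Real.norm_of_nonneg (pathStop_nonneg p _ _)]
      exact pathStop_le_one p _ _
    · refine ((ih (k + 1)).const_mul δ).bdd_mul (c := 1)
        (measurable_const.sub hm).aestronglyMeasurable (ae_of_all _ fun ω => ?_)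
      rw [Real.norm_of_nonneg (sub_nonneg.2 (pathStop_le_one p _ _))]
      linarith [pathStop_nonneg p k (splice m v ω)]

/-- The expected truncated payoff after the first `m` terms of the path `v`. -/
def truncValue (δ K x₀ : ℝ) (p : Rule) (F : ProbabilityMeasure ℝ) (T m : ℕ) (v : ℕ → ℝ) : ℝ :=
  ∫ ω, truncPayoff δ K x₀ p T m (splice m v ω) ∂(iidLaw F)

@[simp] theorem truncValue_zero (δ K x₀ : ℝ) (p : Rule) (F : ProbabilityMeasure ℝ) (m : ℕ)
    (v : ℕ → ℝ) : truncValue δ K x₀ p F 0 m v = 0 := by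
  simp [truncValue, truncPayoff]

theorem integrable_truncPayoff_prod (δ K x₀ : ℝ) (p : Rule) {F : ProbabilityMeasure ℝ}
    (hF : Integrable (fun x : ℝ => x) (F : Measure ℝ)) (T m : ℕ) (v : ℕ → ℝ) :
    Integrable (fun q : ℝ × (ℕ → ℝ) =>
      truncPayoff δ K x₀ p T (m + 1) (splice (m + 1) (Function.update v m q.1) q.2))
      ((F : Measure ℝ).prod (iidLaw F)) := by
  have h := integrable_truncPayoff_splice δ K x₀ p hF T (m + 1) m v
  rw [← map_consSeq F] at h
  simpa only [Function.comp_def, splice_consSeq] using h.comp_measurable measurable_consSeq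

theorem integrable_truncValue_update (δ K x₀ : ℝ) (p : Rule) {F : ProbabilityMeasure ℝ}
    (hF : Integrable (fun x : ℝ => x) (F : Measure ℝ)) (T m : ℕ) (v : ℕ → ℝ) :
    Integrable (fun x => truncValue δ K x₀ p F T (m + 1) (Function.update v m x))
      (F : Measure ℝ) :=
  (integrable_truncPayoff_prod δ K x₀ p hF T m v).integral_prod_left

theorem integral_truncPayoff_splice_succ (δ K x₀ : ℝ) (p : Rule) {F : ProbabilityMeasure ℝ}
    (hF : Integrable (fun x : ℝ => x) (F : Measure ℝ)) (T m : ℕ) (v : ℕ → ℝ) :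
    ∫ ω, truncPayoff δ K x₀ p T (m + 1) (splice m v ω) ∂(iidLaw F) =
      ∫ x, truncValue δ K x₀ p F T (m + 1) (Function.update v m x) ∂(F : Measure ℝ) := by
  have h := integrable_truncPayoff_splice δ K x₀ p hF T (m + 1) m v
  rw [← map_consSeq F] at h
  simp only [truncValue]
  rw [← integral_prod _ (integrable_truncPayoff_prod δ K x₀ p hF T m v)]
  conv_lhs => rw [← map_consSeq F]
  rw [integral_map measurable_consSeq.aemeasurable h.aestronglyMeasurable]
  simp only [splice_consSeq]

theorem splice_of_lt {m i : ℕ} (hi : i < m) (v ω : ℕ → ℝ) : splice m v ω i = v i := by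
  simp [splice, hi]

/-- The Bellman recursion: the present decision depends only on the fixed prefix, and the next draw
is independent of the rest. All later bounds on values are inductions over it. -/
theorem truncValue_succ (δ K x₀ : ℝ) (p : Rule) {F : ProbabilityMeasure ℝ}
    (hF : Integrable (fun x : ℝ => x) (F : Measure ℝ)) (T m : ℕ) (v : ℕ → ℝ) :
    truncValue δ K x₀ p F (T + 1) m v = pathStop p m v * (pathBest x₀ m v + K) +
      (1 - pathStop p m v) *
        (δ * ∫ x, truncValue δ K x₀ p F T (m + 1) (Function.update v m x) ∂(F : Measure ℝ)) := by
  have hs : ∀ ω, pathStop p m (splice m v ω) = pathStop p m v := fun ω =>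
    pathStop_congr p fun i hi => splice_of_lt hi v ω
  have hb : ∀ ω, pathBest x₀ m (splice m v ω) = pathBest x₀ m v := fun ω =>
    pathBest_congr x₀ fun i hi => splice_of_lt hi v ω
  rw [truncValue]
  simp only [truncPayoff, hs, hb]
  rw [integral_add (integrable_const _)
    (((integrable_truncPayoff_splice δ K x₀ p hF T (m + 1) m v).const_mul _).const_mul _),
    integral_const_mul, integral_const_mul, integral_const_mul, integral_truncPayoff_splice_succ δ K x₀ p hF]
  simp

/-! ### The expected payoff as a limit of truncated payoffs -/

theorem integrable_pathWeight_mul (K x₀ : ℝ) (p : Rule) {F : ProbabilityMeasure ℝ}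
    (hF : Integrable (fun x : ℝ => x) (F : Measure ℝ)) (t m : ℕ) (v : ℕ → ℝ) :
    Integrable (fun ω => pathWeight p m t (splice m v ω) *
      (pathBest x₀ (m + t) (splice m v ω) + K)) (iidLaw F) := by
  refine ((integrable_pathBest_splice x₀ hF (m + t) m v).add (integrable_const K)).bdd_mul (c := 1)
    ((measurable_pathWeight p m t).comp (measurable_splice m v)).aestronglyMeasurable
    (ae_of_all _ fun ω => ?_)
  rw [Real.norm_of_nonneg (pathWeight_nonneg p _ _ _)]
  exact pathWeight_le_one p _ _ _

theorem integrable_pathWeight (p : Rule) (F : ProbabilityMeasure ℝ) (t m : ℕ) (v : ℕ → ℝ) :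
    Integrable (fun ω => pathWeight p m t (splice m v ω)) (iidLaw F) := by
  refine Integrable.of_bound (C := 1)
    ((measurable_pathWeight p m t).comp (measurable_splice m v)).aestronglyMeasurable
    (ae_of_all _ fun ω => ?_)
  rw [Real.norm_of_nonneg (pathWeight_nonneg p _ _ _)]
  exact pathWeight_le_one p _ _ _

theorem truncValue_eq_sum (δ K x₀ : ℝ) (p : Rule) {F : ProbabilityMeasure ℝ}
    (hF : Integrable (fun x : ℝ => x) (F : Measure ℝ)) (T m : ℕ) (v : ℕ → ℝ) :
    truncValue δ K x₀ p F T m v = ∑ t ∈ Finset.range T,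
      δ ^ t * ∫ ω, pathWeight p m t (splice m v ω) *
        (pathBest x₀ (m + t) (splice m v ω) + K) ∂(iidLaw F) := by
  simp only [truncValue, truncPayoff_eq_sum]
  rw [integral_finsetSum _ fun t _ => (integrable_pathWeight_mul K x₀ p hF t m v).const_mul _]
  simp only [integral_const_mul]

/-- The accumulated cost is `(1 - δ^t)` times the cost of searching forever, so it can be absorbed
into the value of the alternatives. -/
theorem stopPayoff_eq {δ : ℝ} (hδ1 : δ < 1) (κ x₀ : ℝ) {n : ℕ} (h : Fin n → ℝ) (ω : ℕ → ℝ)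
    (t : ℕ) :
    stopPayoff δ κ x₀ h ω t = δ ^ t * (pathBest x₀ (n + t) (splice n (pad h) ω) +
      δ * κ / (1 - δ)) - δ * κ / (1 - δ) := by
  have h1 : (1 - δ) ≠ 0 := by linarith
  have hsum : (∑ k ∈ Finset.Icc 1 t, δ ^ k) = (δ - δ ^ t * δ) / (1 - δ) := by
    induction t with
    | zero => simp
    | succ t ih =>
      rw [Finset.sum_Icc_succ_top (by omega), ih]
      field_simp
      ring
  rw [stopPayoff, hsum, extendHist_eq_splice, pathBest]
  field_simp
  ring

/-- After the shift all terms are nonnegative, so the uniform bound `C` gives summability. This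
matters: the `tsum` of a divergent series is `0`, which would make `envPayoff` meaningless. -/
theorem tendsto_truncValue {δ κ x₀ : ℝ} (hδ0 : 0 < δ) (hδ1 : δ < 1) (hκ : 0 ≤ κ) (hx₀ : 0 < x₀)
    (p : Rule) {F : ProbabilityMeasure ℝ}
    (hF : Integrable (fun x : ℝ => x) (F : Measure ℝ)) {n : ℕ} (h : Fin n → ℝ) {C : ℝ}
    (hC : ∀ T, truncValue δ (δ * κ / (1 - δ)) x₀ p F T n (pad h) ≤ C) :
    Tendsto (fun T => truncValue δ (δ * κ / (1 - δ)) x₀ p F T n (pad h)) atTop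
      (𝓝 (envPayoff δ κ x₀ p F h + δ * κ / (1 - δ))) := by
  have hK : 0 ≤ δ * κ / (1 - δ) := div_nonneg (by positivity) (by linarith)
  have hpay := fun (ω : ℕ → ℝ) t => stopPayoff_eq hδ1 κ x₀ h ω t
  set K := δ * κ / (1 - δ) with hKdef
  set a : ℕ → ℝ := fun t => δ ^ t * ∫ ω, pathWeight p n t (splice n (pad h) ω) *
        (pathBest x₀ (n + t) (splice n (pad h) ω) + K) ∂(iidLaw F) with ha
  set c : ℕ → ℝ := fun t => ∫ ω, pathWeight p n t (splice n (pad h) ω) ∂(iidLaw F) with hc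
  have ha0 : ∀ t, 0 ≤ a t := fun t => mul_nonneg (by positivity) <| integral_nonneg fun ω =>
    mul_nonneg (pathWeight_nonneg p _ _ _)
      (by linarith [le_pathBest x₀ (n + t) (splice n (pad h) ω)])
  have hc0 : ∀ t, 0 ≤ c t := fun t => integral_nonneg fun ω => pathWeight_nonneg p _ _ _
  have hasum : Summable a := summable_of_sum_range_le ha0 fun T => by
    rw [ha, ← truncValue_eq_sum δ K x₀ p hF]
    exact hC T
  have hcsum : Summable c := summable_of_sum_range_le (c := 1) hc0 fun T => by
    rw [hc, ← integral_finsetSum _ fun t _ => integrable_pathWeight p F t n (pad h)]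
    calc _ ≤ ∫ _, (1 : ℝ) ∂(iidLaw F) := integral_mono
            (integrable_finsetSum _ fun t _ => integrable_pathWeight p F t n (pad h))
            (integrable_const _) fun ω => sum_pathWeight_le_one p T n _
      _ = 1 := by simp
  have hterm : ∀ t, ∫ ω, stopWeight p h ω t * stopPayoff δ κ x₀ h ω t ∂(iidLaw F) =
      a t - K * c t := fun t => by
    simp only [stopWeight_eq, hpay, ha, hc]
    rw [← integral_const_mul, ← integral_const_mul, ← integral_sub
      ((integrable_pathWeight_mul K x₀ p hF t n (pad h)).const_mul _)
      ((integrable_pathWeight p F t n (pad h)).const_mul _)]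
    congr 1
    funext ω
    ring
  have henv : envPayoff δ κ x₀ p F h + K = ∑' t, a t := by
    rw [envPayoff]
    simp only [hterm]
    rw [hasum.tsum_sub (hcsum.mul_left K), tsum_mul_left]
    simp only [stopWeight_eq, hc]
    ring
  rw [henv]
  refine hasum.hasSum.tendsto_sum_nat.congr fun T => ?_
  rw [truncValue_eq_sum δ K x₀ p hF]

/-! ### Reservation values -/

/-- The discounted expectation of the better one of `m` and a new draw plus `K`. -/
def contValue (δ K : ℝ) (F : ProbabilityMeasure ℝ) (m : ℝ) : ℝ :=
  δ * ∫ x, max m (x + K) ∂(F : Measure ℝ)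

theorem integrable_max_add {F : ProbabilityMeasure ℝ}
    (hF : Integrable (fun x : ℝ => x) (F : Measure ℝ)) (m K : ℝ) :
    Integrable (fun x => max m (x + K)) (F : Measure ℝ) :=
  (integrable_const m).sup (hF.add (integrable_const K))

theorem contValue_mono {δ K : ℝ} (hδ0 : 0 < δ) {F : ProbabilityMeasure ℝ}
    (hF : Integrable (fun x : ℝ => x) (F : Measure ℝ)) : Monotone (contValue δ K F) :=
  fun _ _ h => mul_le_mul_of_nonneg_left (integral_mono (integrable_max_add hF _ K)
    (integrable_max_add hF _ K) fun _ => max_le_max_right _ h) hδ0.le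

/-- Slope at most `δ < 1`: this gives continuity, a crossing with the diagonal, and the persistence
of `contValue ≤ id` above it. -/
theorem contValue_le_add {δ K : ℝ} (hδ0 : 0 < δ) {F : ProbabilityMeasure ℝ}
    (hF : Integrable (fun x : ℝ => x) (F : Measure ℝ)) {m m' : ℝ} (h : m ≤ m') :
    contValue δ K F m' ≤ contValue δ K F m + δ * (m' - m) := by
  rw [contValue, contValue, ← mul_add]
  refine mul_le_mul_of_nonneg_left ?_ hδ0.le
  calc ∫ x, max m' (x + K) ∂(F : Measure ℝ)
      ≤ ∫ x, (max m (x + K) + (m' - m)) ∂(F : Measure ℝ) :=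
        integral_mono (integrable_max_add hF _ K)
          ((integrable_max_add hF _ K).add (integrable_const _)) fun x => by
            refine max_le ?_ ?_
            · linarith [le_max_left m (x + K)]
            · linarith [le_max_right m (x + K)]
    _ = _ := by
        rw [integral_add (integrable_max_add hF _ K) (integrable_const _)]
        simp

theorem continuous_contValue {δ K : ℝ} (hδ0 : 0 < δ) {F : ProbabilityMeasure ℝ}
    (hF : Integrable (fun x : ℝ => x) (F : Measure ℝ)) : Continuous (contValue δ K F) := by
  refine (LipschitzWith.of_dist_le_mul (K := δ.toNNReal) fun a b => ?_).continuous
  rw [Real.dist_eq, Real.dist_eq, Real.coe_toNNReal δ hδ0.le]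
  rcases le_total a b with h | h
  · rw [abs_sub_comm, abs_of_nonneg (sub_nonneg.2 (contValue_mono hδ0 hF h)), abs_sub_comm a b,
      abs_of_nonneg (sub_nonneg.2 h)]
    linarith [contValue_le_add (K := K) hδ0 hF h]
  · rw [abs_of_nonneg (sub_nonneg.2 (contValue_mono hδ0 hF h)), abs_of_nonneg (sub_nonneg.2 h)]
    linarith [contValue_le_add (K := K) hδ0 hF h]

/-- There is a level `R ≥ b` from which on search does not pay, and which is either `b` itself or
the level at which searching and stopping are equally good. -/
theorem exists_reservation {δ : ℝ} (K : ℝ) (hδ0 : 0 < δ) (hδ1 : δ < 1) {F : ProbabilityMeasure ℝ}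
    (hF : Integrable (fun x : ℝ => x) (F : Measure ℝ)) (b : ℝ) :
    ∃ R, b ≤ R ∧ contValue δ K F R ≤ R ∧ (R = b ∨ contValue δ K F R = R) := by
  by_cases hb : contValue δ K F b ≤ b
  · exact ⟨b, le_rfl, hb, Or.inl rfl⟩
  push Not at hb
  -- The point where the line of slope `δ` through `(b, contValue b)`, which dominates `contValue`
  -- to the right of `b`, meets the diagonal.
  set M := b + (contValue δ K F b - b) / (1 - δ) with hM
  have hbM : b ≤ M := by
    have : 0 ≤ (contValue δ K F b - b) / (1 - δ) := div_nonneg (by linarith) (by linarith)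
    linarith
  have hMM : contValue δ K F M ≤ M := by
    have h1 := contValue_le_add (K := K) hδ0 hF hbM
    have h2 : (M - b) * (1 - δ) = contValue δ K F b - b := by
      rw [hM, add_sub_cancel_left, div_mul_cancel₀ _ (by linarith)]
    nlinarith
  obtain ⟨R, hR, hRe⟩ := intermediate_value_Icc hbM
    (continuous_id.sub (continuous_contValue (K := K) hδ0 hF)).continuousOn
    (show (0 : ℝ) ∈ Set.Icc _ _ from ⟨sub_nonpos.2 hb.le, sub_nonneg.2 hMM⟩)
  have hRe' : R = contValue δ K F R := sub_eq_zero.1 hRe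
  exact ⟨R, hR.1, hRe'.ge, Or.inr hRe'.symm⟩

theorem contValue_le_self {δ K : ℝ} (hδ0 : 0 < δ) (hδ1 : δ < 1) {F : ProbabilityMeasure ℝ}
    (hF : Integrable (fun x : ℝ => x) (F : Measure ℝ)) {R m : ℝ} (hR : contValue δ K F R ≤ R)
    (hm : R ≤ m) : contValue δ K F m ≤ m := by
  nlinarith [contValue_le_add (K := K) hδ0 hF hm]

/-- `max R (best + K)` is a supersolution of the Bellman recursion: it dominates stopping, and above
`R` continuing does not increase it. -/
theorem truncValue_le {δ K x₀ : ℝ} (hδ0 : 0 < δ) (hδ1 : δ < 1) (p : Rule)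
    {F : ProbabilityMeasure ℝ} (hF : Integrable (fun x : ℝ => x) (F : Measure ℝ)) {R : ℝ}
    (hR0 : 0 ≤ R) (hR : contValue δ K F R ≤ R) (T m : ℕ) (v : ℕ → ℝ) :
    truncValue δ K x₀ p F T m v ≤ max R (pathBest x₀ m v + K) := by
  induction T generalizing m v with
  | zero => simpa using Or.inl hR0
  | succ T ih =>
    rw [truncValue_succ δ K x₀ p hF]
    have hc : δ * ∫ x, truncValue δ K x₀ p F T (m + 1) (Function.update v m x) ∂(F : Measure ℝ) ≤
        max R (pathBest x₀ m v + K) := by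
      refine le_trans ?_ (contValue_le_self hδ0 hδ1 hF hR (le_max_left R (pathBest x₀ m v + K)))
      refine mul_le_mul_of_nonneg_left ?_ hδ0.le
      refine integral_mono (integrable_truncValue_update δ K x₀ p hF T m v)
        (integrable_max_add hF _ _) fun x => (ih _ _).trans_eq ?_
      simp only [pathBest_update, max_add_add_right, max_assoc]
    have h1 := pathStop_nonneg p m v
    have h2 := pathStop_le_one p m v
    nlinarith [le_max_right R (pathBest x₀ m v + K)]

/-- The truncated value of the stationary rule is bounded below by an affine function of the
optimal value, up to an error that vanishes geometrically in the horizon. -/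
theorem le_truncValue_const {δ K x₀ : ℝ} (hδ0 : 0 < δ) (hδ1 : δ < 1)
    {F : ProbabilityMeasure ℝ} (hF : Integrable (fun x : ℝ => x) (F : Measure ℝ)) {b R : ℝ}
    (hb0 : 0 ≤ b) (hbK : 3 * K ≤ b) (hbR : b ≤ R) (hR : contValue δ K F R ≤ R)
    (hRb : R = b ∨ contValue δ K F R = R) (T m : ℕ) (v : ℕ → ℝ) (hbv : b ≤ pathBest x₀ m v + K) :
    max R (pathBest x₀ m v + K) / 2 - R / 4 + 3 * K / 4 -
        (1 / (2 - δ)) ^ T * max R (pathBest x₀ m v + K) ≤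
      truncValue δ K x₀ (Rule.const ((1 - δ) / (2 - δ)) (one_sub_div_mem hδ0 hδ1)) F T m v := by
  induction T generalizing m v with
  | zero =>
    have := le_max_left R (pathBest x₀ m v + K)
    -- At horizon `0` the error term is the full maximum, and `3K ≤ R` makes the left side
    -- nonpositive.
    simp only [pow_zero, truncValue_zero]
    linarith
  | succ T ih =>
    rw [truncValue_succ δ K x₀ _ hF]
    set p := Rule.const ((1 - δ) / (2 - δ)) (one_sub_div_mem hδ0 hδ1) with hp
    set y := pathBest x₀ m v + K with hy
    set g := max R y with hg
    have hps : pathStop p m v = (1 - δ) / (2 - δ) := rfl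
    have h2δ : 0 < 2 - δ := by linarith
    have hε : 0 ≤ (1 / (2 - δ)) ^ T := by positivity
    set ε := (1 / (2 - δ)) ^ T with hεdef
    have hIx := integrable_max_add hF g K
    have hint : δ * ∫ x, (max g (x + K) / 2 - R / 4 + 3 * K / 4 - ε * max g (x + K))
        ∂(F : Measure ℝ) =
          contValue δ K F g / 2 + δ * (- R / 4 + 3 * K / 4) - ε * contValue δ K F g := by
      have h3 : ∀ x, max g (x + K) / 2 - R / 4 + 3 * K / 4 - ε * max g (x + K) =
          (1 / 2 - ε) * max g (x + K) + (- R / 4 + 3 * K / 4) := fun x => by ring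
      simp only [h3]
      rw [integral_add (hIx.const_mul _) (integrable_const _), integral_const_mul, contValue]
      simp
      ring
    have hc : contValue δ K F g / 2 + δ * (- R / 4 + 3 * K / 4) - ε * contValue δ K F g ≤
        δ * ∫ x, truncValue δ K x₀ p F T (m + 1) (Function.update v m x) ∂(F : Measure ℝ) := by
      rw [← hint]
      refine mul_le_mul_of_nonneg_left ?_ hδ0.le
      refine integral_mono (((((hIx.div_const 2).sub (integrable_const _)).add
        (integrable_const _))).sub (hIx.const_mul ε))
        (integrable_truncValue_update δ K x₀ p hF T m v) fun x => ?_
      have h4 : max R (pathBest x₀ (m + 1) (Function.update v m x) + K) = max g (x + K) := by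
        simp only [hg, hy, pathBest_update, max_add_add_right, max_assoc]
      have := ih (m + 1) (Function.update v m x)
        (by rw [pathBest_update, ← max_add_add_right]; exact hbv.trans (le_max_left _ _))
      simpa only [h4] using this
    have hgg : contValue δ K F g ≤ g := contValue_le_self hδ0 hδ1 hF hR (le_max_left R y)
    have hgε : ε * contValue δ K F g ≤ ε * g := mul_le_mul_of_nonneg_left hgg hε
    have hone : 1 - (1 - δ) / (2 - δ) = 1 / (2 - δ) := by field_simp; ring
    have hmain : g / 2 - R / 4 + 3 * K / 4 ≤ (1 - δ) / (2 - δ) * y +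
        1 / (2 - δ) * (contValue δ K F g / 2 + δ * (- R / 4 + 3 * K / 4)) := by
      -- After clearing `2 - δ` a factor `1 - δ` cancels. If stopping is optimal (`g = y`), the
      -- bound `contValue g ≥ δ g` reduces the claim to `3K ≤ R`; if `contValue R = R`, the `R`
      -- terms cancel and `3K/2 ≤ y` remains.
      rw [div_mul_eq_mul_div, div_mul_eq_mul_div, ← add_div, le_div_iff₀ h2δ]
      rcases le_total R y with h | h
      · have hgy : g = y := max_eq_right h
        have h5 : δ * g ≤ contValue δ K F g := by
          refine mul_le_mul_of_nonneg_left ?_ hδ0.le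
          calc g = ∫ _, g ∂(F : Measure ℝ) := by simp
            _ ≤ _ := integral_mono (integrable_const _) hIx fun x => le_max_left _ _
        rw [hgy] at h5 ⊢
        nlinarith
      · have hgR : g = R := max_eq_left h
        have h5 : contValue δ K F R = R ∨ y = R := by
          rcases hRb with h6 | h6
          · exact Or.inr (le_antisymm h (h6 ▸ hbv))
          · exact Or.inl h6
        rw [hgR]
        rcases h5 with h5 | h5
        · rw [h5]; nlinarith
        · have h5' : δ * R ≤ contValue δ K F R := by
            refine mul_le_mul_of_nonneg_left ?_ hδ0.le
            calc R = ∫ _, R ∂(F : Measure ℝ) := by simp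
              _ ≤ _ := integral_mono (integrable_const _) (integrable_max_add hF _ _)
                fun x => le_max_left _ _
          rw [h5]; nlinarith
    rw [hps, hone, pow_succ]
    have h7 : 0 ≤ 1 / (2 - δ) := by positivity
    have h8 := mul_le_mul_of_nonneg_left hc h7
    have h9 := mul_le_mul_of_nonneg_left hgε h7
    linarith

/-! ### The stationary rule attains a quarter of the optimal payoff -/

theorem pathBest_pad (x₀ : ℝ) {n : ℕ} (h : Fin n → ℝ) : pathBest x₀ n (pad h) = best x₀ h := by
  simp [pathBest, pad]

theorem le_best (x₀ : ℝ) {n : ℕ} (h : Fin n → ℝ) : x₀ ≤ best x₀ h :=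
  (best_le_iff.1 le_rfl).1

theorem exists_envPayoff_bound {δ κ x₀ : ℝ} (hδ0 : 0 < δ) (hδ1 : δ < 1) (hκ : 0 ≤ κ)
    (hx₀ : 0 < x₀) (hcost : 2 * δ * κ / (1 - δ) ≤ x₀) {F : ProbabilityMeasure ℝ}
    (hF : Integrable (fun x : ℝ => x) (F : Measure ℝ)) {n : ℕ} (h : Fin n → ℝ) :
    ∃ V, 0 < V ∧ (∀ p, envPayoff δ κ x₀ p F h ≤ V) ∧ V / 4 ≤
      envPayoff δ κ x₀ (Rule.const ((1 - δ) / (2 - δ)) (one_sub_div_mem hδ0 hδ1)) F h := by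
  have hlim := fun p C => tendsto_truncValue (C := C) hδ0 hδ1 hκ hx₀ p hF h
  have hcost' : 2 * (δ * κ / (1 - δ)) ≤ x₀ := by
    rwa [show 2 * (δ * κ / (1 - δ)) = 2 * δ * κ / (1 - δ) by ring]
  have hK : 0 ≤ δ * κ / (1 - δ) := div_nonneg (by positivity) (by linarith)
  set K := δ * κ / (1 - δ) with hKdef
  have hxb := le_best x₀ h
  obtain ⟨R, hbR, hR, hRb⟩ := exists_reservation K hδ0 hδ1 hF (best x₀ h + K)
  have hmax : max R (pathBest x₀ n (pad h) + K) = R := by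
    rw [pathBest_pad]; exact max_eq_left hbR
  have hle : ∀ p T, truncValue δ K x₀ p F T n (pad h) ≤ R := fun p T =>
    (truncValue_le hδ0 hδ1 p hF (by linarith) hR T n (pad h)).trans_eq hmax
  -- At the current history the maximum equals `R`, so the lower bound tends to `R/4 + 3K/4 = (R -
  -- K)/4 + K`.
  refine ⟨R - K, by linarith, fun p => ?_, ?_⟩
  · have := le_of_tendsto' (hlim p R (hle p)) (hle p)
    linarith
  · set p := Rule.const ((1 - δ) / (2 - δ)) (one_sub_div_mem hδ0 hδ1) with hp
    have hpow : Tendsto (fun T : ℕ => R / 2 - R / 4 + 3 * K / 4 - (1 / (2 - δ)) ^ T * R) atTop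
        (𝓝 (R / 2 - R / 4 + 3 * K / 4 - 0 * R)) :=
      tendsto_const_nhds.sub ((tendsto_pow_atTop_nhds_zero_of_lt_one
        (div_nonneg zero_le_one (by linarith))
        ((div_lt_one (by linarith)).2 (by linarith))).mul_const R)
    have := le_of_tendsto_of_tendsto' hpow (hlim p R (hle p)) fun T => by
      have := le_truncValue_const hδ0 hδ1 hF (by linarith) (by linarith) hbR hR hRb T n (pad h)
        (by rw [pathBest_pad])
      rwa [hmax] at this
    linarith

/-! ### Averaging over the posterior -/

namespace Prior

variable {𝓕 : Set (ProbabilityMeasure ℝ)}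

theorem likelihood_nonneg (F : ProbabilityMeasure ℝ) {n : ℕ} (h : Fin n → ℝ) :
    0 ≤ likelihood F h :=
  Finset.prod_nonneg fun _ _ => measureReal_nonneg

theorem posterior_nonneg (μ : Prior 𝓕) {n : ℕ} {h : Fin n → ℝ} (hμ : μ.Consistent h)
    (F : ProbabilityMeasure ℝ) : 0 ≤ μ.posterior h F :=
  div_nonneg (mul_nonneg (μ.nonneg F) (likelihood_nonneg F h)) hμ.le

theorem sum_posterior (μ : Prior 𝓕) {n : ℕ} {h : Fin n → ℝ} (hμ : μ.Consistent h) :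
    ∑ F ∈ μ.weight.support, μ.posterior h F = 1 := by
  simp only [posterior]
  rw [← Finset.sum_div]
  exact div_self hμ.ne'

/-- Payoffs are linear in the posterior, so the posterior mean of the bounds for single environments
serves as `V`. -/
theorem bddAbove_payoff {δ κ x₀ : ℝ} (hδ0 : 0 < δ) (hδ1 : δ < 1) (hκ : 0 ≤ κ)
    (hx₀ : 0 < x₀) (hcost : 2 * δ * κ / (1 - δ) ≤ x₀)
    (hint : ∀ F ∈ 𝓕, Integrable (fun x : ℝ => x) (F : Measure ℝ))
    (μ : Prior 𝓕) {n : ℕ} {h : Fin n → ℝ} (hμ : μ.Consistent h) :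
    ∃ V, 0 < V ∧ (∀ p, μ.payoff δ κ x₀ p h ≤ V) ∧ V / 4 ≤
      μ.payoff δ κ x₀ (Rule.const ((1 - δ) / (2 - δ)) (one_sub_div_mem hδ0 hδ1)) h := by
  choose! V hV0 hV1 hV2 using fun (F : ProbabilityMeasure ℝ)
    (hF : Integrable (fun x : ℝ => x) (F : Measure ℝ)) =>
    exists_envPayoff_bound hδ0 hδ1 hκ hx₀ hcost hF h
  have hs : ∀ F ∈ μ.weight.support, Integrable (fun x : ℝ => x) (F : Measure ℝ) := fun F hF =>
    hint F (μ.support_subset F hF)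
  refine ⟨∑ F ∈ μ.weight.support, μ.posterior h F * V F, ?_, fun p => ?_, ?_⟩
  · obtain ⟨F, hF, hpos⟩ := Finset.exists_lt_of_sum_lt (s := μ.weight.support)
      (f := fun _ => (0 : ℝ)) (g := μ.posterior h) (by rw [μ.sum_posterior hμ]; simp)
    exact Finset.sum_pos' (fun G hG => mul_nonneg (μ.posterior_nonneg hμ G) (hV0 G (hs G hG)).le)
      ⟨F, hF, mul_pos hpos (hV0 F (hs F hF))⟩
  · exact Finset.sum_le_sum fun F hF =>
      mul_le_mul_of_nonneg_left (hV1 F (hs F hF) p) (μ.posterior_nonneg hμ F)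
  · rw [Finset.sum_div]
    refine Finset.sum_le_sum fun F hF => ?_
    rw [mul_div_assoc]
    exact mul_le_mul_of_nonneg_left (hV2 F (hs F hF)) (μ.posterior_nonneg hμ F)

end Prior

namespace Prior

variable {𝓕 : Set (ProbabilityMeasure ℝ)}

/-- Boundedness is essential here: a real supremum of an unbounded family is `0` by convention. -/
theorem payoff_le_optPayoff {δ κ x₀ : ℝ} (hδ0 : 0 < δ) (hδ1 : δ < 1) (hκ : 0 ≤ κ)
    (hx₀ : 0 < x₀) (hcost : 2 * δ * κ / (1 - δ) ≤ x₀)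
    (hint : ∀ F ∈ 𝓕, Integrable (fun x : ℝ => x) (F : Measure ℝ))
    (μ : Prior 𝓕) {n : ℕ} {h : Fin n → ℝ} (hμ : μ.Consistent h) (p : Rule) :
    μ.payoff δ κ x₀ p h ≤ μ.optPayoff δ κ x₀ h := by
  obtain ⟨V, -, hV1, -⟩ := μ.bddAbove_payoff hδ0 hδ1 hκ hx₀ hcost hint hμ
  exact le_ciSup (f := fun p => μ.payoff δ κ x₀ p h) ⟨V, by rintro _ ⟨p, rfl⟩; exact hV1 p⟩ p

theorem optPayoff_pos {δ κ x₀ : ℝ} (hδ0 : 0 < δ) (hδ1 : δ < 1) (hκ : 0 ≤ κ)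
    (hx₀ : 0 < x₀) (hcost : 2 * δ * κ / (1 - δ) ≤ x₀)
    (hint : ∀ F ∈ 𝓕, Integrable (fun x : ℝ => x) (F : Measure ℝ))
    (μ : Prior 𝓕) {n : ℕ} {h : Fin n → ℝ} (hμ : μ.Consistent h) :
    0 < μ.optPayoff δ κ x₀ h := by
  obtain ⟨V, hV0, -, hV2⟩ := μ.bddAbove_payoff hδ0 hδ1 hκ hx₀ hcost hint hμ
  exact lt_of_lt_of_le (by linarith)
    (hV2.trans (μ.payoff_le_optPayoff hδ0 hδ1 hκ hx₀ hcost hint hμ _))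

end Prior

theorem quarter_le_performanceRatio {δ κ x₀ : ℝ} (hδ0 : 0 < δ) (hδ1 : δ < 1) (hκ : 0 ≤ κ)
    (hx₀ : 0 < x₀) (hcost : 2 * δ * κ / (1 - δ) ≤ x₀) {𝓕 : Set (ProbabilityMeasure ℝ)}
    (hint : ∀ F ∈ 𝓕, Integrable (fun x : ℝ => x) (F : Measure ℝ)) :
    ((1 / 4 : ℝ) : EReal) ≤ performanceRatio δ κ x₀ 𝓕
      (Rule.const ((1 - δ) / (2 - δ)) (one_sub_div_mem hδ0 hδ1)) := by
  refine le_iInf fun n => le_iInf fun h => le_iInf fun μ => le_iInf fun hμ => ?_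
  obtain ⟨V, hV0, hV1, hV2⟩ := μ.bddAbove_payoff hδ0 hδ1 hκ hx₀ hcost hint hμ
  have hopt : μ.optPayoff δ κ x₀ h ≤ V :=
    haveI : Nonempty Rule := ⟨Rule.const _ (one_sub_div_mem hδ0 hδ1)⟩
    ciSup_le hV1
  rw [EReal.coe_le_coe_iff, le_div_iff₀ (μ.optPayoff_pos hδ0 hδ1 hκ hx₀ hcost hint hμ)]
  linarith

/-! ### The discounted probability of stopping along a path -/

/-- The expected discount factor at the time when `p` stops, along the path `v` from time `m`. -/
def stopDiscount (δ : ℝ) (p : Rule) (m : ℕ) (v : ℕ → ℝ) : ℝ :=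
  ∑' t : ℕ, δ ^ t * pathWeight p m t v

theorem summable_stopDiscount {δ : ℝ} (hδ0 : 0 < δ) (hδ1 : δ < 1) (p : Rule) (m : ℕ)
    (v : ℕ → ℝ) : Summable fun t : ℕ => δ ^ t * pathWeight p m t v :=
  Summable.of_nonneg_of_le (fun t => mul_nonneg (by positivity) (pathWeight_nonneg p m t v))
    (fun _ => mul_le_of_le_one_right (by positivity) (pathWeight_le_one p _ _ v))
    (summable_geometric_of_lt_one hδ0.le hδ1)

/-- Matches the Bellman recursion term by term, so `stopDiscount` can appear in inductive bounds on
values. -/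
theorem stopDiscount_eq {δ : ℝ} (hδ0 : 0 < δ) (hδ1 : δ < 1) (p : Rule) (m : ℕ) (v : ℕ → ℝ) :
    stopDiscount δ p m v =
      pathStop p m v + (1 - pathStop p m v) * (δ * stopDiscount δ p (m + 1) v) := by
  rw [stopDiscount, (summable_stopDiscount hδ0 hδ1 p m v).tsum_eq_zero_add, stopDiscount,
    ← tsum_mul_left, ← tsum_mul_left]
  simp only [pathWeight_succ, pathWeight_zero, pow_zero, one_mul]
  congr 1
  exact tsum_congr fun t => by ring

theorem stopDiscount_nonneg {δ : ℝ} (hδ0 : 0 < δ) (p : Rule) (m : ℕ) (v : ℕ → ℝ) :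
    0 ≤ stopDiscount δ p m v :=
  tsum_nonneg fun t => mul_nonneg (by positivity) (pathWeight_nonneg p m t v)

theorem stopDiscount_le_one {δ : ℝ} (hδ0 : 0 < δ) (hδ1 : δ < 1) (p : Rule) (m : ℕ)
    (v : ℕ → ℝ) : stopDiscount δ p m v ≤ 1 :=
  Real.tsum_le_of_sum_range_le
    (fun t => mul_nonneg (by positivity) (pathWeight_nonneg p m t v)) fun T =>
      (Finset.sum_le_sum fun t _ => mul_le_of_le_one_left (pathWeight_nonneg p m t v)
        (pow_le_one₀ hδ0.le hδ1.le)).trans (sum_pathWeight_le_one p T m v)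

/-! ### Environments with rare high alternatives -/

/-- `F` draws `z` with probability `σ`, each entry of `h` with probability `w`, and otherwise `0`. -/
structure IsRareEnv (F : ProbabilityMeasure ℝ) {n : ℕ} (h : Fin n → ℝ) (z σ w : ℝ) : Prop where
  nonneg_z : 0 ≤ σ
  nonneg_w : 0 ≤ w
  le_one : σ + n * w ≤ 1
  integrable : ∀ f : ℝ → ℝ, Integrable f (F : Measure ℝ)
  integral_eq : ∀ f : ℝ → ℝ, ∫ x, f x ∂(F : Measure ℝ) =
    (1 - (σ + n * w)) * f 0 + (σ * f z + w * ∑ i, f (h i))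

/-- The measure underlying an environment with rare high alternatives. -/
def rareMeasure {n : ℕ} (h : Fin n → ℝ) (z σ w : ℝ) : Measure ℝ :=
  ENNReal.ofReal (1 - (σ + n * w)) • Measure.dirac 0 +
    (ENNReal.ofReal σ • Measure.dirac z +
      ENNReal.ofReal w • ∑ i, Measure.dirac (h i))

section RareMeasure

variable {n : ℕ} (h : Fin n → ℝ) (z : ℝ) {σ w : ℝ}

theorem isProbabilityMeasure_rareMeasure (hσ : 0 ≤ σ) (hw : 0 ≤ w) (hs : σ + n * w ≤ 1) :
    IsProbabilityMeasure (rareMeasure h z σ w) := by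
  constructor
  have hnw : 0 ≤ (n : ℝ) * w := by positivity
  have : ENNReal.ofReal w * n = ENNReal.ofReal (w * n) := by
    rw [ENNReal.ofReal_mul hw, ENNReal.ofReal_natCast]
  simp only [rareMeasure, Measure.add_apply, Measure.smul_apply, Measure.dirac_apply_of_mem,
    Set.mem_univ, smul_eq_mul, mul_one, Measure.finsetSum_apply, Finset.sum_const,
    Finset.card_univ, Fintype.card_fin, nsmul_eq_mul, this]
  rw [← ENNReal.ofReal_add hσ (by linarith), ← ENNReal.ofReal_add (by linarith) (by linarith)]
  rw [show 1 - (σ + n * w) + (σ + w * n) = 1 by ring, ENNReal.ofReal_one]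

theorem isRareEnv_rareMeasure (hσ : 0 ≤ σ) (hw : 0 ≤ w) (hs : σ + n * w ≤ 1) :
    IsRareEnv ⟨rareMeasure h z σ w, isProbabilityMeasure_rareMeasure h z hσ hw hs⟩ h z σ w := by
  have h0 : ∀ f : ℝ → ℝ, Integrable f (ENNReal.ofReal (1 - (σ + n * w)) • Measure.dirac (0 : ℝ)) :=
    fun f => (integrable_dirac (by simp)).smul_measure ENNReal.ofReal_ne_top
  have h1 : ∀ f : ℝ → ℝ, Integrable f (ENNReal.ofReal σ • Measure.dirac z) :=
    fun f => (integrable_dirac (by simp)).smul_measure ENNReal.ofReal_ne_top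
  have h2 : ∀ f : ℝ → ℝ, Integrable f (∑ i, Measure.dirac (h i)) := fun f =>
    integrable_finsetSum_measure.2 fun i _ => integrable_dirac (by simp)
  have h3 : ∀ f : ℝ → ℝ, Integrable f (ENNReal.ofReal w • ∑ i, Measure.dirac (h i)) :=
    fun f => (h2 f).smul_measure ENNReal.ofReal_ne_top
  refine ⟨hσ, hw, hs, fun f => (h0 f).add_measure ((h1 f).add_measure (h3 f)), fun f => ?_⟩
  change ∫ x, f x ∂(rareMeasure h z σ w) = _
  rw [rareMeasure, integral_add_measure (h0 f) ((h1 f).add_measure (h3 f)),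
    integral_add_measure (h1 f) (h3 f), integral_smul_measure, integral_smul_measure,
    integral_smul_measure, integral_finsetSum_measure fun i _ => integrable_dirac (by simp)]
  simp only [integral_dirac, smul_eq_mul]
  rw [ENNReal.toReal_ofReal hσ, ENNReal.toReal_ofReal hw, ENNReal.toReal_ofReal (by linarith)]

theorem rareMeasure_compl_eq_zero {S : Set ℝ} (hS : MeasurableSet S) (h0 : (0 : ℝ) ∈ S)
    (hz : z ∈ S) (hh : ∀ i, h i ∈ S) : rareMeasure h z σ w Sᶜ = 0 := by
  simp [rareMeasure, hS.compl, h0, hz, hh]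

end RareMeasure

namespace IsRareEnv

variable {F : ProbabilityMeasure ℝ} {n : ℕ} {h : Fin n → ℝ} {z σ w : ℝ}

theorem real_singleton_pos (hF : IsRareEnv F h z σ w) (hw : 0 < w) (i : Fin n) :
    0 < (F : Measure ℝ).real {h i} := by
  have h1 := hF.integral_eq (Set.indicator {h i} 1)
  rw [integral_indicator_one (measurableSet_singleton _)] at h1
  rw [h1]
  have hpos : ∀ x : ℝ, 0 ≤ Set.indicator {h i} (1 : ℝ → ℝ) x := fun x =>
    Set.indicator_nonneg (fun _ _ => zero_le_one) x
  have h2 : (1 : ℝ) ≤ ∑ j, Set.indicator {h i} (1 : ℝ → ℝ) (h j) := by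
    refine le_trans ?_ (Finset.single_le_sum (fun j _ => hpos (h j)) (Finset.mem_univ i))
    simp
  have h3 := mul_nonneg (sub_nonneg.2 hF.le_one) (hpos 0)
  have h4 := mul_nonneg hF.nonneg_z (hpos z)
  nlinarith

theorem likelihood_pos (hF : IsRareEnv F h z σ w) (hw : 0 < w) : 0 < likelihood F h :=
  Finset.prod_pos fun i _ => hF.real_singleton_pos hw i

theorem truncValue_succ_eq (hF : IsRareEnv F h z σ w) (δ K x₀ : ℝ) (p : Rule) (T m : ℕ)
    (v : ℕ → ℝ) :
    truncValue δ K x₀ p F (T + 1) m v = pathStop p m v * (pathBest x₀ m v + K) +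
      (1 - pathStop p m v) * (δ *
        ((1 - (σ + n * w)) * truncValue δ K x₀ p F T (m + 1) (Function.update v m 0) +
          (σ * truncValue δ K x₀ p F T (m + 1) (Function.update v m z) +
            w * ∑ i, truncValue δ K x₀ p F T (m + 1) (Function.update v m (h i))))) := by
  rw [truncValue_succ δ K x₀ p (hF.integrable _), hF.integral_eq]

theorem sum_le_of_le (hF : IsRareEnv F h z σ w) {f : Fin n → ℝ} {c : ℝ} (hf : ∀ i, f i ≤ c) :
    w * ∑ i, f i ≤ n * w * c := by
  have : ∑ i, f i ≤ n * c := by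
    simpa using Finset.sum_le_sum fun i (_ : i ∈ Finset.univ) => hf i
  nlinarith [mul_le_mul_of_nonneg_left this hF.nonneg_w]

theorem truncValue_le_top (hF : IsRareEnv F h z σ w) {δ K x₀ : ℝ} (hδ0 : 0 < δ) (hδ1 : δ < 1)
    (p : Rule) (hz : 0 ≤ z) (hzK : 0 ≤ z + K) (hhz : ∀ i, h i ≤ z) (T m : ℕ) (v : ℕ → ℝ)
    (hv : pathBest x₀ m v ≤ z) : truncValue δ K x₀ p F T m v ≤ z + K := by
  induction T generalizing m v with
  | zero => simpa using hzK
  | succ T ih =>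
    rw [hF.truncValue_succ_eq]
    have hstep : ∀ x ≤ z, truncValue δ K x₀ p F T (m + 1) (Function.update v m x) ≤ z + K :=
      fun x hx => ih _ _ (by rw [pathBest_update]; exact max_le hv hx)
    have h1 := mul_le_mul_of_nonneg_left (hstep 0 hz) (sub_nonneg.2 hF.le_one)
    have h2 := mul_le_mul_of_nonneg_left (hstep z le_rfl) hF.nonneg_z
    have h3 := hF.sum_le_of_le fun i => hstep (h i) (hhz i)
    set S := (1 - (σ + n * w)) * truncValue δ K x₀ p F T (m + 1) (Function.update v m 0) +
          (σ * truncValue δ K x₀ p F T (m + 1) (Function.update v m z) +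
            w * ∑ i, truncValue δ K x₀ p F T (m + 1) (Function.update v m (h i))) with hS
    have h4 : S ≤ z + K := by rw [hS]; linarith
    have h5 : δ * S ≤ z + K := by nlinarith
    have h6 := mul_le_mul_of_nonneg_left h5 (sub_nonneg.2 (pathStop_le_one p m v))
    have h7 := mul_le_mul_of_nonneg_left hv (pathStop_nonneg p m v)
    linarith

/-- As long as only zeros follow, the rule earns `z + K` discounted to its stopping time. Any other
draw, of probability `σ + n * w` per round, is conceded the maximal value `z + K`. -/
theorem truncValue_le_of_found (hF : IsRareEnv F h z σ w) {δ K x₀ : ℝ} (hδ0 : 0 < δ)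
    (hδ1 : δ < 1) (p : Rule) (hz : 0 ≤ z) (hzK : 0 ≤ z + K) (hhz : ∀ i, h i ≤ z) (T m : ℕ)
    (v : ℕ → ℝ) (hv : ∀ i, m ≤ i → v i = 0) (hvz : pathBest x₀ m v = z) :
    truncValue δ K x₀ p F T m v ≤
      (z + K) * (stopDiscount δ p m v + (σ + n * w) * (δ / (1 - δ))) := by
  have hs0 : 0 ≤ σ + n * w := add_nonneg hF.nonneg_z (mul_nonneg n.cast_nonneg hF.nonneg_w)
  have ha0 : 0 ≤ δ / (1 - δ) := div_nonneg hδ0.le (by linarith)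
  -- `δ/(1-δ) = δ + δ² + ⋯` adds up a constant loss per draw over all future rounds.
  have ha : δ * (1 + δ / (1 - δ)) = δ / (1 - δ) := by
    have : 1 - δ ≠ 0 := by linarith
    field_simp; ring
  induction T generalizing m with
  | zero =>
    simpa using mul_nonneg hzK
      (add_nonneg (stopDiscount_nonneg hδ0 p m v) (mul_nonneg hs0 ha0))
  | succ T ih =>
    rw [hF.truncValue_succ_eq, stopDiscount_eq hδ0 hδ1, hvz]
    have hupd : Function.update v m 0 = v := by
      rw [Function.update_eq_self_iff, hv m le_rfl]
    have h0 : truncValue δ K x₀ p F T (m + 1) (Function.update v m 0) ≤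
        (z + K) * (stopDiscount δ p (m + 1) v + (σ + n * w) * (δ / (1 - δ))) := by
      rw [hupd]
      refine ih (m + 1) (fun i hi => hv i (by omega)) ?_
      rw [pathBest_succ, hvz, hv m le_rfl, max_eq_left hz]
    have hstep : ∀ x ≤ z, truncValue δ K x₀ p F T (m + 1) (Function.update v m x) ≤ z + K :=
      fun x hx => hF.truncValue_le_top hδ0 hδ1 p hz hzK hhz T _ _
        (by rw [pathBest_update]; exact max_le hvz.le hx)
    have h1 := mul_le_mul_of_nonneg_left h0 (sub_nonneg.2 hF.le_one)
    have h2 := mul_le_mul_of_nonneg_left (hstep z le_rfl) hF.nonneg_z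
    have h3 := hF.sum_le_of_le fun i => hstep (h i) (hhz i)
    set S := (1 - (σ + n * w)) * truncValue δ K x₀ p F T (m + 1) (Function.update v m 0) +
          (σ * truncValue δ K x₀ p F T (m + 1) (Function.update v m z) +
            w * ∑ i, truncValue δ K x₀ p F T (m + 1) (Function.update v m (h i))) with hS
    set D := stopDiscount δ p (m + 1) v with hD
    have hD0 : 0 ≤ D := stopDiscount_nonneg hδ0 p _ v
    set s := σ + n * w with hs
    set a := δ / (1 - δ) with haa
    have h4 : S ≤ (z + K) * (D + s * a + s) := by
      have : 0 ≤ s * ((z + K) * (D + s * a)) := by positivity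
      have e1 : σ * (z + K) + n * w * (z + K) = s * (z + K) := by rw [hs]; ring
      rw [hS]; linarith
    have h5 : δ * S ≤ (z + K) * (δ * D + s * a) := by
      calc δ * S ≤ δ * ((z + K) * (D + s * a + s)) := mul_le_mul_of_nonneg_left h4 hδ0.le
        _ = (z + K) * (δ * D + s * (δ * (1 + a))) := by ring
        _ = _ := by rw [ha]
    have h6 := mul_le_mul_of_nonneg_left h5 (sub_nonneg.2 (pathStop_le_one p m v))
    have h7 : 0 ≤ pathStop p m v * ((z + K) * (s * a)) :=
      mul_nonneg (pathStop_nonneg p m v) (by positivity)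
    linarith

/-- Along zeros, `(1 - stopDiscount) * (δ/(1-δ))` is the expected discounted number of draws made
before stopping. Each finds `z` with probability `σ`, after which `truncValue_le_of_found` applies;
draws repeating entries of `h` are conceded the value `z + K`. -/
theorem truncValue_le_of_not_found (hF : IsRareEnv F h z σ w) {δ K x₀ : ℝ} (hδ0 : 0 < δ)
    (hδ1 : δ < 1) (p : Rule) (hz : 0 ≤ z) (hzK : 0 ≤ z + K) (hhz : ∀ i, h i ≤ z)
    {X : Set ℝ} (hzX : z ∈ X) {D : ℝ} (hD0 : 0 ≤ D)
    (hD : ∀ m (v : ℕ → ℝ), (∀ i, v i ∈ X) → (∀ i, m ≤ i → v i = 0) → stopDiscount δ p m v ≤ D)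
    {y : ℝ} (hy : 0 ≤ y) (hyz : y ≤ z) (hyK : 0 ≤ y + K)
    (T m : ℕ) (v : ℕ → ℝ) (hvX : ∀ i, v i ∈ X) (hv : ∀ i, m ≤ i → v i = 0)
    (hvy : pathBest x₀ m v ≤ y) :
    truncValue δ K x₀ p F T m v ≤ y + K +
      σ * (z + K) * (D + (σ + n * w) * (δ / (1 - δ))) *
        ((1 - stopDiscount δ p m v) * (δ / (1 - δ))) + n * w * (z + K) * (δ / (1 - δ)) := by
  have hs0 : 0 ≤ σ + n * w := add_nonneg hF.nonneg_z (mul_nonneg n.cast_nonneg hF.nonneg_w)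
  have hτ0 : 0 ≤ n * w := mul_nonneg n.cast_nonneg hF.nonneg_w
  have hσ := hF.nonneg_z
  have ha0 : 0 ≤ δ / (1 - δ) := div_nonneg hδ0.le (by linarith)
  have ha : δ * (1 + δ / (1 - δ)) = δ / (1 - δ) := by
    have : 1 - δ ≠ 0 := by linarith
    field_simp; ring
  have hM0 : 0 ≤ σ * (z + K) * (D + (σ + n * w) * (δ / (1 - δ))) := by positivity
  induction T generalizing m with
  | zero =>
    have := sub_nonneg.2 (stopDiscount_le_one hδ0 hδ1 p m v)
    rw [truncValue_zero]
    positivity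
  | succ T ih =>
    rw [hF.truncValue_succ_eq, stopDiscount_eq hδ0 hδ1]
    have hupd : Function.update v m 0 = v := by
      rw [Function.update_eq_self_iff, hv m le_rfl]
    have h0 := ih (m + 1) (fun i hi => hv i (by omega))
      (by rw [pathBest_succ, hv m le_rfl]; exact max_le hvy hy)
    have hfound : truncValue δ K x₀ p F T (m + 1) (Function.update v m z) ≤
        (z + K) * (D + (σ + n * w) * (δ / (1 - δ))) := by
      have hpad : ∀ i, m + 1 ≤ i → Function.update v m z i = 0 := fun i hi => by
        rw [Function.update_of_ne (by omega), hv i (by omega)]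
      refine (hF.truncValue_le_of_found hδ0 hδ1 p hz hzK hhz T _ _ hpad ?_).trans ?_
      · rw [pathBest_update, max_eq_right (hvy.trans hyz)]
      -- The history extended by `z` is still a history over `X`, so the same `D` bounds the
      -- stopping rate after success.
      · refine mul_le_mul_of_nonneg_left (add_le_add_left (hD _ _ (fun i => ?_) hpad) _) hzK
        by_cases hi : i = m
        · subst hi; simpa using hzX
        · rw [Function.update_of_ne hi]; exact hvX i
    have hstep : ∀ x ≤ z, truncValue δ K x₀ p F T (m + 1) (Function.update v m x) ≤ z + K :=
      fun x hx => hF.truncValue_le_top hδ0 hδ1 p hz hzK hhz T _ _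
        (by rw [pathBest_update]; exact max_le (hvy.trans hyz) hx)
    have h2 := mul_le_mul_of_nonneg_left hfound hσ
    have h3 := hF.sum_le_of_le fun i => hstep (h i) (hhz i)
    rw [hupd]
    set d := stopDiscount δ p (m + 1) v with hd
    have hd1 : d ≤ 1 := stopDiscount_le_one hδ0 hδ1 p _ v
    set s := σ + n * w with hs
    set a := δ / (1 - δ) with haa
    set M := σ * (z + K) * (D + s * a) with hM
    set A := y + K + M * ((1 - d) * a) + n * w * (z + K) * a with hA
    have hA0 : 0 ≤ A := by
      have := sub_nonneg.2 hd1
      rw [hA]; positivity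
    have h1 := mul_le_mul_of_nonneg_left h0 (sub_nonneg.2 hF.le_one)
    set S := (1 - s) * truncValue δ K x₀ p F T (m + 1) v +
          (σ * truncValue δ K x₀ p F T (m + 1) (Function.update v m z) +
            w * ∑ i, truncValue δ K x₀ p F T (m + 1) (Function.update v m (h i))) with hS
    have h4 : S ≤ A + M + n * w * (z + K) := by
      have : 0 ≤ s * A := mul_nonneg hs0 hA0
      have e : σ * ((z + K) * (D + s * a)) = M := by rw [hM]; ring
      rw [hS]; linarith
    have h5 : δ * S ≤ y + K + M * (a * (1 - δ * d)) + n * w * (z + K) * a := by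
      calc δ * S ≤ δ * (A + M + n * w * (z + K)) := mul_le_mul_of_nonneg_left h4 hδ0.le
        _ = δ * (y + K) + M * (δ * (1 + a) - δ * a * d) + n * w * (z + K) * (δ * (1 + a)) := by
            rw [hA]; ring
        _ ≤ _ := by
            rw [ha]
            have : δ * (y + K) ≤ y + K := mul_le_of_le_one_left hyK hδ1.le
            linarith
    have h6 := mul_le_mul_of_nonneg_left h5 (sub_nonneg.2 (pathStop_le_one p m v))
    have h7 : 0 ≤ pathStop p m v * (n * w * (z + K) * a) :=
      mul_nonneg (pathStop_nonneg p m v) (by positivity)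
    have h8 := mul_le_mul_of_nonneg_left hvy (pathStop_nonneg p m v)
    linarith

end IsRareEnv

/-! ### The threshold rule as a benchmark -/

theorem measurable_best (x₀ : ℝ) (n : ℕ) : Measurable fun h : Fin n → ℝ => best x₀ h := by
  have hm : Measurable fun h : Fin n → ℝ => pad h := by
    refine measurable_pi_lambda _ fun i => ?_
    unfold pad
    split_ifs
    · exact measurable_pi_apply _
    · exact measurable_const
  simpa only [Function.comp_def, pathBest_pad] using (measurable_pathBest x₀ n).comp hm

/-- The rule that stops as soon as the best alternative so far is at least `z`. -/
def Rule.threshold (x₀ z : ℝ) : Rule where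
  stopProb _ h := Set.indicator {y | z ≤ y} 1 (best x₀ h)
  measurable_stopProb n :=
    (measurable_const.indicator measurableSet_Ici).comp (measurable_best x₀ n)
  stopProb_mem _ _ := ⟨Set.indicator_nonneg (fun _ _ => zero_le_one) _,
    Set.indicator_le_self' (f := 1) (fun _ _ => zero_le_one) _⟩

theorem pathStop_threshold_of_le {x₀ z : ℝ} {m : ℕ} {v : ℕ → ℝ} (h : z ≤ pathBest x₀ m v) :
    pathStop (Rule.threshold x₀ z) m v = 1 :=
  Set.indicator_of_mem (s := {y | z ≤ y}) h _

theorem pathStop_threshold_of_lt {x₀ z : ℝ} {m : ℕ} {v : ℕ → ℝ} (h : pathBest x₀ m v < z) :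
    pathStop (Rule.threshold x₀ z) m v = 0 :=
  Set.indicator_of_notMem (s := {y | z ≤ y}) (not_le.2 h) _

/-- The fraction solves `q = δ(σ + (1 - σ)q)`: it is the expected discount factor at the first draw
that succeeds with probability `σ`. The term `δ ^ T * (z + K)` pays for truncation. -/
theorem IsRareEnv.le_truncValue_threshold {F : ProbabilityMeasure ℝ} {n : ℕ} {h : Fin n → ℝ}
    {z σ w : ℝ} (hF : IsRareEnv F h z σ w) {δ K x₀ : ℝ} (hδ0 : 0 < δ) (hδ1 : δ < 1)
    (hzK : 0 ≤ z + K) (T m : ℕ) (v : ℕ → ℝ) :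
    (z + K) * (σ * δ / (1 - δ + σ * δ)) - δ ^ T * (z + K) ≤
      truncValue δ K x₀ (Rule.threshold x₀ z) F T m v := by
  have hσδ : 0 ≤ σ * δ := mul_nonneg hF.nonneg_z hδ0.le
  have hden : 0 < 1 - δ + σ * δ := by linarith
  have hq : σ * δ / (1 - δ + σ * δ) ≤ 1 := (div_le_one hden).2 (by linarith)
  have hqeq : σ * δ / (1 - δ + σ * δ) * (1 - δ + σ * δ) = σ * δ := div_mul_cancel₀ _ hden.ne'
  set q := σ * δ / (1 - δ + σ * δ) with hqdef
  have hle : (z + K) * q ≤ z + K := mul_le_of_le_one_right hzK hq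
  have hfound : ∀ T m (v : ℕ → ℝ), z ≤ pathBest x₀ m v →
      (z + K) - δ ^ T * (z + K) ≤ truncValue δ K x₀ (Rule.threshold x₀ z) F T m v := by
    intro T m v hv
    cases T with
    | zero => simp
    | succ T =>
      rw [hF.truncValue_succ_eq, pathStop_threshold_of_le hv]
      have : 0 ≤ δ ^ (T + 1) * (z + K) := by positivity
      linarith
  induction T generalizing m v with
  | zero => simpa using hle
  | succ T ih =>
    rcases le_or_gt z (pathBest x₀ m v) with hv | hv
    · linarith [hfound (T + 1) m v hv]
    rw [hF.truncValue_succ_eq, pathStop_threshold_of_lt hv]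
    have h1 := mul_le_mul_of_nonneg_left (ih (m + 1) (Function.update v m 0))
      (sub_nonneg.2 hF.le_one)
    have h2 := mul_le_mul_of_nonneg_left (hfound T (m + 1) (Function.update v m z)
      (by rw [pathBest_update]; exact le_max_right _ _)) hF.nonneg_z
    have h3 : n * w * ((z + K) * q - δ ^ T * (z + K)) ≤
        w * ∑ i, truncValue δ K x₀ (Rule.threshold x₀ z) F T (m + 1)
          (Function.update v m (h i)) := by
      have := hF.sum_le_of_le (f := fun i => -truncValue δ K x₀ (Rule.threshold x₀ z) F T (m + 1)
          (Function.update v m (h i))) fun i => neg_le_neg (ih (m + 1) (Function.update v m (h i)))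
      rw [Finset.sum_neg_distrib] at this
      linarith
    rw [pow_succ]
    have h4 := mul_le_mul_of_nonneg_left (add_le_add h1 (add_le_add h2 h3)) hδ0.le
    have h5 : (z + K) * q = (z + K) * (δ * (1 - σ) * q + σ * δ) := by
      rw [← hqeq]; ring
    linarith

/-! ### No rule guarantees more than a quarter of the optimal payoff -/

/-- The degenerate prior at the environment `F`. -/
def Prior.dirac {𝓕 : Set (ProbabilityMeasure ℝ)} {F : ProbabilityMeasure ℝ} (hF : F ∈ 𝓕) :
    Prior 𝓕 where
  weight := Finsupp.single F 1
  nonneg G := by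
    classical
    rw [Finsupp.single_apply]
    split_ifs <;> simp
  sum_eq_one := by simp
  support_subset G hG := by
    rw [Finsupp.support_single F one_ne_zero, Finset.mem_singleton] at hG
    exact hG ▸ hF

theorem Prior.histProb_dirac {𝓕 : Set (ProbabilityMeasure ℝ)} {F : ProbabilityMeasure ℝ}
    (hF : F ∈ 𝓕) {n : ℕ} (h : Fin n → ℝ) : (Prior.dirac hF).histProb h = likelihood F h := by
  simp [Prior.histProb, Prior.dirac]

theorem Prior.payoff_dirac {𝓕 : Set (ProbabilityMeasure ℝ)} {F : ProbabilityMeasure ℝ}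
    (hF : F ∈ 𝓕) {n : ℕ} {h : Fin n → ℝ} (hpos : 0 < likelihood F h) (δ κ x₀ : ℝ) (p : Rule) :
    (Prior.dirac hF).payoff δ κ x₀ p h = envPayoff δ κ x₀ p F h := by
  rw [Prior.payoff]
  simp only [Prior.posterior, Prior.histProb_dirac]
  simp [Prior.dirac, hpos.ne']

theorem pad_restrict {m : ℕ} {v : ℕ → ℝ} (hv : ∀ i, m ≤ i → v i = 0) :
    pad (fun i : Fin m => v i) = v := by
  funext i
  by_cases hi : i < m
  · simp [pad, hi]
  · simp [pad, hi, hv i (not_lt.1 hi)]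

/-- Among the histories over `X`, one at which the discounted stopping probability is within `ε`
of the supremum `D`. -/
theorem exists_near_sup_stopDiscount {δ : ℝ} (hδ0 : 0 < δ) (hδ1 : δ < 1) (p : Rule) {X : Set ℝ}
    (hX0 : (0 : ℝ) ∈ X) {ε : ℝ} (hε : 0 < ε) :
    ∃ D : ℝ, 0 ≤ D ∧ D ≤ 1 ∧ (∀ m (v : ℕ → ℝ), (∀ i, v i ∈ X) → (∀ i, m ≤ i → v i = 0) →
      stopDiscount δ p m v ≤ D) ∧
      ∃ (n : ℕ) (v : ℕ → ℝ), (∀ i, v i ∈ X) ∧ (∀ i, n ≤ i → v i = 0) ∧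
        D - ε < stopDiscount δ p n v := by
  set A : Set ℝ := {d | ∃ (m : ℕ) (v : ℕ → ℝ), (∀ i, v i ∈ X) ∧ (∀ i, m ≤ i → v i = 0) ∧
    stopDiscount δ p m v = d} with hA
  have hne : A.Nonempty := ⟨_, 0, 0, fun _ => hX0, fun _ _ => rfl, rfl⟩
  have hle : ∀ d ∈ A, d ≤ 1 := by
    rintro _ ⟨m, v, -, -, rfl⟩
    exact stopDiscount_le_one hδ0 hδ1 p m v
  have hbdd : BddAbove A := ⟨1, hle⟩
  refine ⟨sSup A, Real.sSup_nonneg ?_, csSup_le hne hle, fun m v hvX hv =>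
    le_csSup hbdd ⟨m, v, hvX, hv, rfl⟩, ?_⟩
  · rintro _ ⟨m, v, -, -, rfl⟩
    exact stopDiscount_nonneg hδ0 p m v
  · obtain ⟨_, ⟨n, v, hvX, hv, rfl⟩, hlt⟩ := exists_lt_of_lt_csSup hne (sub_lt_self (sSup A) hε)
    exact ⟨n, v, hvX, hv, hlt⟩

/-- If a rule stops at the discounted rate `d` after the history, and at no history at a rate above
`D`, then there is a small probability `σ` of finding an alternative `z` with `σ² (z + K) = 1` that
brings the bound on its payoff below the multiple `c > D (1 - d)` of the optimal payoff. -/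
theorem exists_rare_probability {δ : ℝ} (hδ0 : 0 < δ) (hδ1 : δ < 1) (K y D d : ℝ) (n : ℕ) {c : ℝ}
    (hc : D * (1 - d) < c) :
    ∃ η : ℝ, 0 < η ∧ ∀ σ : ℝ, 0 < σ → σ < η → σ + n * σ ^ 2 ≤ 1 ∧
      y * σ + (D + (σ + n * σ ^ 2) * (δ / (1 - δ))) * ((1 - d) * (δ / (1 - δ))) +
        n * σ * (δ / (1 - δ)) ≤ c * (δ / (1 - δ + σ * δ) - K * σ) := by
  have ha : 0 < δ / (1 - δ) := div_pos hδ0 (by linarith)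
  have h1 : ∀ᶠ σ : ℝ in 𝓝 0, σ + n * σ ^ 2 < 1 := by
    have : ContinuousAt (fun σ : ℝ => σ + n * σ ^ 2) 0 := by fun_prop
    exact this.eventually_lt continuousAt_const (by simp)
  have h2 : ∀ᶠ σ : ℝ in 𝓝 0,
      y * σ + (D + (σ + n * σ ^ 2) * (δ / (1 - δ))) * ((1 - d) * (δ / (1 - δ))) +
        n * σ * (δ / (1 - δ)) < c * (δ / (1 - δ + σ * δ) - K * σ) := by
    have hne : 1 - δ + 0 * δ ≠ 0 := by linarith
    have hl : ContinuousAt (fun σ : ℝ =>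
      y * σ + (D + (σ + n * σ ^ 2) * (δ / (1 - δ))) * ((1 - d) * (δ / (1 - δ))) +
        n * σ * (δ / (1 - δ))) 0 := by fun_prop
    have hr : ContinuousAt (fun σ : ℝ => c * (δ / (1 - δ + σ * δ) - K * σ)) 0 := by
      refine continuousAt_const.mul (ContinuousAt.sub (continuousAt_const.div ?_ hne) ?_) <;>
        fun_prop
    refine hl.eventually_lt hr ?_
    -- At `σ = 0` the claim is `D(1-d) < c` times `δ/(1-δ)`; continuity does the rest.
    simp only [mul_zero, zero_mul, ne_eq, OfNat.ofNat_ne_zero, not_false_eq_true, zero_pow,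
      add_zero, sub_zero, zero_add]
    nlinarith
  obtain ⟨η, hη, hball⟩ := Metric.eventually_nhds_iff.1 (h1.and h2)
  refine ⟨η, hη, fun σ hσ0 hση => ?_⟩
  have := hball (show dist σ 0 < η by rwa [Real.dist_eq, sub_zero, abs_of_pos hσ0])
  exact ⟨this.1.le, this.2.le⟩

theorem exists_envPayoff_le {δ κ x₀ : ℝ} (hδ0 : 0 < δ) (hδ1 : δ < 1) (hκ : 0 ≤ κ)
    (hx₀ : 0 < x₀) {X : Set ℝ} (hXmeas : MeasurableSet X) (hX0 : (0 : ℝ) ∈ X)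
    (hX : ¬ BddAbove X) (p : Rule) {ε : ℝ} (hε : 0 < ε) :
    ∃ (n : ℕ) (h : Fin n → ℝ) (F : ProbabilityMeasure ℝ) (z : ℝ), F ∈ environments X ∧
      0 < likelihood F h ∧ envPayoff δ κ x₀ p F h ≤
        (1 / 4 + 2 * ε) * envPayoff δ κ x₀ (Rule.threshold x₀ z) F h := by
  obtain ⟨D, hD0, hD1, hD, n, v, hvX, hv, hlt⟩ :=
    exists_near_sup_stopDiscount hδ0 hδ1 p hX0 hε
  set h : Fin n → ℝ := fun i => v i with hh
  have hpad : pad h = v := pad_restrict hv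
  have hK : 0 ≤ δ * κ / (1 - δ) := div_nonneg (by positivity) (by linarith)
  have hlim := fun q F hF C => tendsto_truncValue (C := C) hδ0 hδ1 hκ hx₀ q (F := F) hF h
  set K := δ * κ / (1 - δ) with hKdef
  set y := best x₀ h with hy
  have hy0 : 0 < y := hx₀.trans_le (le_best x₀ h)
  -- `D(1-d) ≤ D(1-D) + Dε ≤ 1/4 + ε`, by the choice of the history and `D ≤ 1`.
  have hc : D * (1 - stopDiscount δ p n v) < 1 / 4 + 2 * ε := by
    nlinarith [sq_nonneg (D - 1 / 2)]
  obtain ⟨η, hη, hησ⟩ := exists_rare_probability hδ0 hδ1 K (y + K) D (stopDiscount δ p n v) n hc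
  obtain ⟨z, hzX, hz⟩ := not_bddAbove_iff.1 hX (max y (1 / η ^ 2))
  have hyz : y < z := (le_max_left _ _).trans_lt hz
  have hz0 : 0 < z := hy0.trans hyz
  have hzK : 0 < z + K := by linarith
  -- With this scaling the gain `σ(z + K) = 1/σ` outgrows `y + K`. Entries of `h` get probability
  -- `σ²`: positive, so that `h` can occur, while their total contribution, of order `n σ² (z + K) =
  -- n`, stays bounded.
  set σ := 1 / √(z + K) with hσ
  have hsq : 0 < √(z + K) := Real.sqrt_pos.2 hzK
  have hσ0 : 0 < σ := by positivity
  have hσz : σ ^ 2 * (z + K) = 1 := by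
    rw [hσ, div_pow, Real.sq_sqrt hzK.le]
    field_simp
  have hση : σ < η := by
    rw [hσ, div_lt_iff₀ hsq, ← div_lt_iff₀' hη]
    refine Real.lt_sqrt_of_sq_lt ?_
    rw [div_pow, one_pow]
    linarith [le_max_right y (1 / η ^ 2)]
  obtain ⟨hs, hbound⟩ := hησ σ hσ0 hση
  have hprob := isProbabilityMeasure_rareMeasure h z hσ0.le (sq_nonneg σ) hs
  have hF := isRareEnv_rareMeasure h z hσ0.le (sq_nonneg σ) hs
  set F : ProbabilityMeasure ℝ := ⟨rareMeasure h z σ (σ ^ 2), hprob⟩ with hFdef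
  have hFint := hF.integrable fun x => x
  have hhz : ∀ i, h i ≤ z := fun i => ((best_le_iff.1 (le_refl y)).2 i).trans hyz.le
  have hbest : pathBest x₀ n v = y := rfl
  have htop : ∀ q T, truncValue δ K x₀ q F T n (pad h) ≤ z + K := fun q T => by
    rw [hpad]
    exact hF.truncValue_le_top hδ0 hδ1 q hz0.le hzK.le hhz T n v (hbest.trans_le hyz.le)
  refine ⟨n, h, F, z, ⟨rareMeasure_compl_eq_zero h z hXmeas hX0 hzX fun i => hvX i, hFint⟩,
    hF.likelihood_pos (by positivity), ?_⟩
  have hU : envPayoff δ κ x₀ p F h + K ≤ y + K +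
      σ * (z + K) * (D + (σ + n * σ ^ 2) * (δ / (1 - δ))) *
        ((1 - stopDiscount δ p n v) * (δ / (1 - δ))) + n * σ ^ 2 * (z + K) * (δ / (1 - δ)) := by
    refine le_of_tendsto' (hlim p F hFint _ (htop p)) fun T => ?_
    rw [hpad]
    exact hF.truncValue_le_of_not_found hδ0 hδ1 p hz0.le hzK.le hhz hzX hD0 hD hy0.le hyz.le
      (by linarith) T n v hvX hv hbest.le
  have hV : (z + K) * (σ * δ / (1 - δ + σ * δ)) ≤
      envPayoff δ κ x₀ (Rule.threshold x₀ z) F h + K := by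
    have hpow : Tendsto (fun T : ℕ => (z + K) * (σ * δ / (1 - δ + σ * δ)) - δ ^ T * (z + K)) atTop
        (𝓝 ((z + K) * (σ * δ / (1 - δ + σ * δ)) - 0 * (z + K))) :=
      tendsto_const_nhds.sub ((tendsto_pow_atTop_nhds_zero_of_lt_one hδ0.le hδ1).mul_const _)
    have := le_of_tendsto_of_tendsto' hpow (hlim (Rule.threshold x₀ z) F hFint _ (htop _)) fun T =>
      hF.le_truncValue_threshold hδ0 hδ1 hzK.le T n (pad h)
    linarith
  -- Multiplication by `σ` normalises both payoffs to finite limits as `σ → 0`, the form used in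
  -- `exists_rare_probability`.
  have hU' : σ * envPayoff δ κ x₀ p F h ≤ (y + K) * σ +
      (D + (σ + n * σ ^ 2) * (δ / (1 - δ))) * ((1 - stopDiscount δ p n v) * (δ / (1 - δ))) +
        n * σ * (δ / (1 - δ)) := by
    calc σ * envPayoff δ κ x₀ p F h ≤ σ * (y + K +
      σ * (z + K) * (D + (σ + n * σ ^ 2) * (δ / (1 - δ))) *
        ((1 - stopDiscount δ p n v) * (δ / (1 - δ))) + n * σ ^ 2 * (z + K) * (δ / (1 - δ))) :=
          mul_le_mul_of_nonneg_left (by linarith) hσ0.le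
      _ = (y + K) * σ + σ ^ 2 * (z + K) * ((D + (σ + n * σ ^ 2) * (δ / (1 - δ))) *
        ((1 - stopDiscount δ p n v) * (δ / (1 - δ)))) +
          n * σ * (σ ^ 2 * (z + K)) * (δ / (1 - δ)) := by ring
      _ = _ := by rw [hσz]; ring
  have hV' : δ / (1 - δ + σ * δ) - K * σ ≤
      σ * envPayoff δ κ x₀ (Rule.threshold x₀ z) F h := by
    have h1 : δ / (1 - δ + σ * δ) = σ * ((z + K) * (σ * δ / (1 - δ + σ * δ))) := by
      calc δ / (1 - δ + σ * δ) = σ ^ 2 * (z + K) * (δ / (1 - δ + σ * δ)) := by rw [hσz, one_mul]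
        _ = _ := by ring
    have h2 := mul_le_mul_of_nonneg_left hV hσ0.le
    linarith
  have hc0 : 0 ≤ 1 / 4 + 2 * ε := by positivity
  have hfin := hU'.trans (hbound.trans (mul_le_mul_of_nonneg_left hV' hc0))
  refine le_of_mul_le_mul_left ?_ hσ0
  linarith

theorem performanceRatio_le_quarter {δ κ x₀ : ℝ} (hδ0 : 0 < δ) (hδ1 : δ < 1) (hκ : 0 ≤ κ)
    (hx₀ : 0 < x₀) (hcost : 2 * δ * κ / (1 - δ) ≤ x₀) {X : Set ℝ} (hXmeas : MeasurableSet X)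
    (hX0 : (0 : ℝ) ∈ X) (hX : ¬ BddAbove X) (p : Rule) :
    performanceRatio δ κ x₀ (environments X) p ≤ ((1 / 4 : ℝ) : EReal) := by
  have key : ∀ ε : ℝ, 0 < ε →
      performanceRatio δ κ x₀ (environments X) p ≤ ((1 / 4 + 2 * ε : ℝ) : EReal) := by
    intro ε hε
    obtain ⟨n, h, F, z, hFX, hpos, hle⟩ :=
      exists_envPayoff_le hδ0 hδ1 hκ hx₀ hXmeas hX0 hX p hε
    have hcons : (Prior.dirac hFX).Consistent h := by
      rwa [Prior.Consistent, Prior.histProb_dirac]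
    have hint : ∀ G ∈ environments X, Integrable (fun x : ℝ => x) (G : Measure ℝ) :=
      fun G hG => hG.2
    have hratio : performanceRatio δ κ x₀ (environments X) p ≤
        (((Prior.dirac hFX).payoff δ κ x₀ p h / (Prior.dirac hFX).optPayoff δ κ x₀ h : ℝ) :
          EReal) := by
      unfold performanceRatio
      exact iInf_le_of_le n <| iInf_le_of_le h <| iInf_le_of_le (Prior.dirac hFX) <|
        iInf_le _ hcons
    refine hratio.trans ?_
    rw [EReal.coe_le_coe_iff, div_le_iff₀
      ((Prior.dirac hFX).optPayoff_pos hδ0 hδ1 hκ hx₀ hcost hint hcons), Prior.payoff_dirac hFX hpos]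
    -- The threshold rule need not be optimal: its payoff only has to bound the optimal payoff from
    -- below.
    refine hle.trans (mul_le_mul_of_nonneg_left ?_ (by positivity))
    rw [← Prior.payoff_dirac hFX hpos]
    exact (Prior.dirac hFX).payoff_le_optPayoff hδ0 hδ1 hκ hx₀ hcost hint hcons _
  refine EReal.le_of_forall_lt_iff_le.1 fun r hr => ?_
  have := key ((r - 1 / 4) / 2) (by have := EReal.coe_lt_coe_iff.1 hr; linarith)
  rwa [show 1 / 4 + 2 * ((r - 1 / 4) / 2) = r by ring] at this

end RobustSearch

end

theorem theorem3 (δ κ x₀ : ℝ) (hδ0 : 0 < δ) (hδ1 : δ < 1) (hκ : 0 ≤ κ)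
    (X : Set ℝ) (hXmeas : MeasurableSet X) (hXnonneg : ∀ x ∈ X, 0 ≤ x) (hX0 : (0 : ℝ) ∈ X)
    (hx₀ : 0 < x₀) (hcost : 2 * δ * κ / (1 - δ) ≤ x₀) :
    ((1 / 4 : ℝ) : EReal) ≤
        RobustSearch.performanceRatio δ κ x₀ (RobustSearch.environments X)
          (RobustSearch.Rule.const ((1 - δ) / (2 - δ)) (RobustSearch.one_sub_div_mem hδ0 hδ1)) ∧
      (¬ BddAbove X →
        RobustSearch.DynamicallyRobust δ κ x₀ (RobustSearch.environments X)
          (RobustSearch.Rule.const ((1 - δ) / (2 - δ)) (RobustSearch.one_sub_div_mem hδ0 hδ1))) := by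
  have hquarter := RobustSearch.quarter_le_performanceRatio hδ0 hδ1 hκ hx₀ hcost
    (𝓕 := RobustSearch.environments X) fun F hF => hF.2
  exact ⟨hquarter, fun hX => le_antisymm
    (le_iSup (RobustSearch.performanceRatio δ κ x₀ (RobustSearch.environments X)) _)
    (iSup_le fun p => (RobustSearch.performanceRatio_le_quarter hδ0 hδ1 hκ hx₀ hcost hXmeas hX0 hX
      p).trans hquarter)⟩
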